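/- Let $d\ge 1$ be an integer, $p,q,\tau\in[1,\infty)$, $0<a\le 1$, $\alpha,\beta,\gamma\in\mathbb{R}$ and $\mu>1$ with $\tau\le\mu$. Define $\sigma$ by $\gamma=a\sigma+(1-a)\beta$, and assume the balance law $$\frac1\tau+\frac\gamma d=a\Big(\frac1p+\frac{\alpha-1}{d}\Big)+(1-a)\Big(\frac1q+\frac\beta d\Big)$$ and $0\le\alpha-\sigma\le 1$. Write $B_R$ for the open ball of radius $R$ centred at $0$ in $\mathbb{R}^d$. For $u\in L^1_{loc}(\mathbb{R}^d\setminus\{0\})$ (real valued) let $\mathrm{supp}\,u$ be the complement of the largest open set on which $u=0$ almost everywhere, let $\nabla u$ be the distributional gradient of $u$ on $\mathbb{R}^d\setminus\{0\}$, and set $\||x|^\alpha\nabla u\|_{L^p(\mathbb{R}^d\setminus\{0\})}=+\infty$ if $\nabla u\notin [L^p_{loc}(\mathbb{R}^d\setminus\{0\})]^d$. All norms and integrals below take values in $[0,+\infty]$, with the conventions $0\cdot(+\infty)=(+\infty)\cdot 0=0$, $t^0=1$ for all $t\in[0,+\infty]$, and $+\infty\le+\infty$. Then there exists a constant $C>0$,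 depending only on $d,p,q,\tau,a,\alpha,\beta,\gamma,\mu$, such that for all $u\in L^1_{loc}(\mathbb{R}^d\setminus\{0\})$ and all $R_1,R_2>0$: (i) if $\frac1\tau+\frac\gamma d=0$ and $\mathrm{supp}\,u\subset B_{R_2}$, then $$\Big(\int_{\mathbb{R}^d}\frac{|x|^{\gamma\tau}}{\ln^\mu(2R_2/|x|)}|u|^\tau\,dx\Big)^{1/\tau}\le C\,\||x|^\alpha\nabla u\|^a_{L^p(\mathbb{R}^d\setminus\{0\})}\,\||x|^\beta u\|^{1-a}_{L^q(\mathbb{R}^d)};$$ (ii) if $\frac1\tau+\frac\gamma d=0$ and $\mathrm{supp}\,u\cap B_{R_1}=\emptyset$, then $$\Big(\int_{\mathbb{R}^d}\frac{|x|^{\gamma\tau}}{\ln^\mu(2|x|/R_1)}|u|^\tau\,dx\Big)^{1/\tau}\le C\,\||x|^\alpha\nabla u\|^a_{L^p(\mathbb{R}^d\setminus\{0\})}\,\||x|^\beta u\|^{1-a}_{L^q(\mathbb{R}^d)}.$$ In both integrals the integrand is understood to be $0$ where $u=0$. -/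

import Mathlib

open MeasureTheory Set Filter Topology
open scoped ENNReal ContDiff

namespace CKN

/-- The Euclidean space `ℝ^d`. -/
abbrev Space (d : ℕ) : Type := EuclideanSpace ℝ (Fin d)

/-- The support of a function defined up to null sets: the complement of the largest open set
on which `u = 0` almost everywhere. -/
def essSupport {d : ℕ} (u : Space d → ℝ) : Set (Space d) :=
  {x | ¬ ∃ U ∈ 𝓝 x, ∀ᵐ y ∂(volume.restrict U), u y = 0}

/-- `g` is the weak (distributional) gradient of `u` on the open set `ℝ^d ∖ {0}`:
`g ∈ L^1_loc(ℝ^d ∖ {0})` and `∫ u ∇φ = - ∫ φ g` for every `φ ∈ C_c^∞(ℝ^d ∖ {0})`. -/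
structure IsWeakGradient {d : ℕ} (u : Space d → ℝ) (g : Space d → Space d) : Prop where
  locallyIntegrableOn : LocallyIntegrableOn g ({0}ᶜ : Set (Space d)) volume
  integral_eq : ∀ φ : Space d → ℝ, ContDiff ℝ ∞ φ → HasCompactSupport φ →
    tsupport φ ⊆ ({0}ᶜ : Set (Space d)) →
      ∫ x, u x • gradient φ x = - ∫ x, φ x • g x

/-- `g ∈ L^p_loc(ℝ^d ∖ {0})`. -/
def MemLpLoc {d : ℕ} (g : Space d → Space d) (p : ℝ) : Prop :=
  ∀ K : Set (Space d), IsCompact K → K ⊆ ({0}ᶜ : Set (Space d)) →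
    MemLp g (ENNReal.ofReal p) (volume.restrict K)

/-- The weak gradient on `ℝ^d ∖ {0}` is unique up to null sets. -/
theorem IsWeakGradient.ae_eq {d : ℕ} {u : Space d → ℝ} {g h : Space d → Space d}
    (hg : IsWeakGradient u g) (hh : IsWeakGradient u h) :
    g =ᵐ[volume.restrict ({0}ᶜ : Set (Space d))] h := by
  have key : ∀ᵐ x ∂(volume : Measure (Space d)), x ∈ ({0}ᶜ : Set (Space d)) → (g - h) x = 0 := by
    refine IsOpen.ae_eq_zero_of_integral_contDiff_smul_eq_zero isOpen_compl_singleton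
      (hg.locallyIntegrableOn.sub hh.locallyIntegrableOn) ?_
    intro φ hφ hc hs
    have int : ∀ f : Space d → Space d, LocallyIntegrableOn f ({0}ᶜ : Set (Space d)) volume →
        Integrable (fun x => φ x • f x) volume := by
      intro f hf
      have h1 : IntegrableOn f (tsupport φ) volume := hf.integrableOn_compact_subset hs hc
      have h2 : IntegrableOn (fun x => φ x • f x) (tsupport φ) volume :=
        h1.continuousOn_smul hφ.continuous.continuousOn hc
      refine (integrableOn_iff_integrable_of_support_subset ?_).mp h2
      exact (Function.support_smul_subset_left φ f).trans (subset_tsupport φ)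
    have e := (hg.integral_eq φ hφ hc hs).symm.trans (hh.integral_eq φ hφ hc hs)
    simp only [Pi.sub_apply, smul_sub]
    rw [integral_sub (int g hg.locallyIntegrableOn) (int h hh.locallyIntegrableOn),
      neg_injective e, sub_self]
  rw [Filter.EventuallyEq, ae_restrict_iff' (measurableSet_singleton _).compl]
  filter_upwards [key] with x hx hx0
  exact sub_eq_zero.mp (hx hx0)

open Classical in
/-- The quantity `‖ |x|^α ∇u ‖_{L^p(ℝ^d ∖ {0})} ∈ [0, ∞]`, where `∇u` is the distributional
gradient on `ℝ^d ∖ {0}`; it is `∞` if `∇u` does not belong to `L^p_loc(ℝ^d ∖ {0})`.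
It does not depend on the choice of the representative of `∇u`. -/
noncomputable def weightedGradNorm {d : ℕ} (α p : ℝ) (u : Space d → ℝ) : ℝ≥0∞ :=
  if h : ∃ g : Space d → Space d, IsWeakGradient u g ∧ MemLpLoc g p then
    eLpNorm (fun x => ‖x‖ ^ α • h.choose x) (ENNReal.ofReal p)
      (volume.restrict ({0}ᶜ : Set (Space d)))
  else ∞

theorem weightedGradNorm_eq {d : ℕ} {α p : ℝ} {u : Space d → ℝ} {g : Space d → Space d}
    (hg : IsWeakGradient u g) (hp : MemLpLoc g p) :
    weightedGradNorm α p u = eLpNorm (fun x => ‖x‖ ^ α • g x) (ENNReal.ofReal p)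
      (volume.restrict ({0}ᶜ : Set (Space d))) := by
  have h : ∃ g : Space d → Space d, IsWeakGradient u g ∧ MemLpLoc g p := ⟨g, hg, hp⟩
  rw [weightedGradNorm, dif_pos h]
  refine eLpNorm_congr_ae ?_
  filter_upwards [h.choose_spec.1.ae_eq hg] with x hx
  rw [hx]

/-- The quantity `‖ |x|^β u ‖_{L^q(ℝ^d)} ∈ [0, ∞]`. -/
noncomputable def weightedNorm {d : ℕ} (β q : ℝ) (u : Space d → ℝ) : ℝ≥0∞ :=
  eLpNorm (fun x => ‖x‖ ^ β * u x) (ENNReal.ofReal q) volume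

/-- `(∫_{ℝ^d} |x|^{γτ} / ln^μ (2R/|x|) |u|^τ dx)^{1/τ} ∈ [0, ∞]`
(meant for `u` vanishing outside the ball `B_R`). -/
noncomputable def innerLogNorm {d : ℕ} (γ τ μ R : ℝ) (u : Space d → ℝ) : ℝ≥0∞ :=
  (∫⁻ x : Space d, ENNReal.ofReal
    (‖x‖ ^ (γ * τ) / Real.log (2 * R / ‖x‖) ^ μ * |u x| ^ τ)) ^ (1 / τ)

/-- `(∫_{ℝ^d} |x|^{γτ} / ln^μ (2|x|/R) |u|^τ dx)^{1/τ} ∈ [0, ∞]`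
(meant for `u` vanishing on the ball `B_R`). -/
noncomputable def outerLogNorm {d : ℕ} (γ τ μ R : ℝ) (u : Space d → ℝ) : ℝ≥0∞ :=
  (∫⁻ x : Space d, ENNReal.ofReal
    (‖x‖ ^ (γ * τ) / Real.log (2 * ‖x‖ / R) ^ μ * |u x| ^ τ)) ^ (1 / τ)

end CKN

/-! When 1/τ + γ/d = 0, the weight |x|^(γτ) is |x|^(-d), so all dyadic shells carry the same weight
up to scaling. Let U_n be the scale-invariant L^τ size of u on the n-th shell (`shellNorm`) and V_n
that of u - u(2·). A change of variables identifies U_(n+1) with the size of u(2·) on shell n, so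
each of U_n, U_(n+1) is at most the other plus V_n. The support condition makes U vanish on the
first shell past R, and telescoping from there bounds the k-th U by a sum of k+1 of the V's. On that
shell the logarithm is at least (k+1) log 2, so the left side is controlled by Σ (k+1)^(-μ) U_k^τ.
The discrete Hardy inequality `exists_discrete_hardy`, where 1 < μ and τ ≤ μ enter, bounds this by Σ
V_j^τ.

It remains to estimate one V. Subtracting the dilate plays the role of subtracting a mean: the L^p
norm of f - f(2·) on a shell is controlled by the gradient alone. A cutoff of this difference
therefore satisfies a Gagliardo-Nirenberg inequality on a fixed ball with no lower-order term
(`exists_gagliardoNirenberg`, `exists_eLpNorm'_sub_dilate_le`). Rescaling gives the same bound on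
every shell, the powers of the radius cancelling by criticality. Mollification extends it to weak
gradients (`exists_shell_estimate`).

The condition α - σ ≥ 0 is the exponent condition of the local inequality. The condition α - σ ≤ 1
says aτ/p + (1-a)τ/q ≥ 1, which is what lets the products over shells be summed by Hölder for
sequences (`tsum_rpow_mul_rpow_le`, `exists_dyadic_estimate`). -/

namespace CKN

/-! ### Hölder and interpolation inequalities for Lebesgue norms -/

section Interpolation

variable {X F : Type*} [MeasurableSpace X] {ν : Measure X} [NormedAddCommGroup F]

theorem eLpNorm'_le_of_support_subset {f : X → F} {A : Set X} {s t : ℝ} (hs : 0 < s) (hst : s ≤ t)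
    (hf : AEStronglyMeasurable f ν) (hA : Function.support f ⊆ A) :
    eLpNorm' f s ν ≤ eLpNorm' f t ν * ν A ^ (1 / s - 1 / t) := by
  have key : ∀ r : ℝ, 0 < r → eLpNorm' f r ν = eLpNorm' f r (ν.restrict A) := by
    intro r hr
    unfold eLpNorm'
    congr 1
    refine (setLIntegral_eq_of_support_subset ?_).symm
    intro x hx
    apply hA
    intro h0
    simp [h0, hr] at hx
  rw [key s hs, key t (hs.trans_le hst)]
  simpa using eLpNorm'_le_eLpNorm'_mul_rpow_measure_univ hs hst hf.restrict

theorem eLpNorm'_interpolation {f : X → F} {t t₀ t₁ l : ℝ} (ht : 0 < t) (ht₀ : 0 < t₀)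
    (ht₁ : 0 < t₁) (hl₀ : 0 ≤ l) (hl₁ : l ≤ 1) (h : 1 / t = l / t₀ + (1 - l) / t₁)
    (hf : AEStronglyMeasurable f ν) :
    eLpNorm' f t ν ≤ eLpNorm' f t₀ ν ^ l * eLpNorm' f t₁ ν ^ (1 - l) := by
  have h1 : ∀ x, ‖f x‖ₑ ^ t = (‖f x‖ₑ ^ t₀) ^ (l * t / t₀) * (‖f x‖ₑ ^ t₁) ^ ((1 - l) * t / t₁) := by
    intro x
    rw [← ENNReal.rpow_mul, ← ENNReal.rpow_mul, ← ENNReal.rpow_add_of_nonneg]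
    · congr 1
      field_simp
      ring
    · have : 0 ≤ 1 - l := by linarith
      positivity
    · have : 0 ≤ 1 - l := by linarith
      positivity
  have hl : 0 ≤ 1 - l := by linarith
  have h2 : l * t / t₀ + (1 - l) * t / t₁ = 1 := by
    have : l * t / t₀ + (1 - l) * t / t₁ = t * (l / t₀ + (1 - l) / t₁) := by ring
    rw [this, ← h]
    field_simp
  have h3 := ENNReal.lintegral_mul_norm_pow_le (μ := ν) (f := fun x => ‖f x‖ₑ ^ t₀)
    (g := fun x => ‖f x‖ₑ ^ t₁) (hf.enorm.pow_const _) (hf.enorm.pow_const _)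
    (p := l * t / t₀) (q := (1 - l) * t / t₁) (by positivity) (by positivity) h2
  unfold eLpNorm'
  simp_rw [h1]
  calc _ ≤ ((∫⁻ x, ‖f x‖ₑ ^ t₀ ∂ν) ^ (l * t / t₀) *
        (∫⁻ x, ‖f x‖ₑ ^ t₁ ∂ν) ^ ((1 - l) * t / t₁)) ^ (1 / t) := by
        gcongr
    _ = _ := by
      rw [ENNReal.mul_rpow_of_nonneg _ _ (by positivity), ← ENNReal.rpow_mul, ← ENNReal.rpow_mul,
        ← ENNReal.rpow_mul, ← ENNReal.rpow_mul]
      congr 2 <;> field_simp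

end Interpolation

/-! ### Sobolev and Poincaré inequalities on a fixed ball -/

theorem lintegral_rpow_mul_fderiv_le {d : ℕ} {w : Space d → ℝ} (hw : ContDiff ℝ 1 w)
    {p s : ℝ} (hp : 1 < p) (hs : 1 < s) :
    ∫⁻ x, ‖w x‖ₑ ^ (s - 1) * ‖fderiv ℝ w x‖ₑ ≤
      eLpNorm' w ((s - 1) * (p / (p - 1))) volume ^ (s - 1) * eLpNorm' (fderiv ℝ w) p volume := by
  have hc : Continuous w := hw.continuous
  have hc' : Continuous (fderiv ℝ w) := hw.continuous_fderiv one_ne_zero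
  have hpq : (p / (p - 1)).HolderConjugate p := (Real.HolderConjugate.conjExponent hp).symm
  refine (ENNReal.lintegral_mul_le_Lp_mul_Lq volume hpq
    (f := fun x => ‖w x‖ₑ ^ (s - 1)) (g := fun x => ‖fderiv ℝ w x‖ₑ)
    (hc.measurable.enorm.pow_const _).aemeasurable
    hc'.measurable.enorm.aemeasurable).trans_eq ?_
  unfold eLpNorm'
  congr 1
  simp_rw [← ENNReal.rpow_mul]
  congr 1
  have : p - 1 ≠ 0 := by linarith
  have : s - 1 ≠ 0 := by linarith
  field_simp

theorem enorm_le_lintegral_fderiv {w : Space 1 → ℝ} (hw : ContDiff ℝ 1 w)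
    (hc : HasCompactSupport w) (x : Space 1) : ‖w x‖ₑ ≤ ∫⁻ y, ‖fderiv ℝ w y‖ₑ := by
  -- The one-dimensional Euclidean space is identified with ℝ by a measure-preserving map, so that
  -- the fundamental theorem of calculus on ℝ applies.
  let e : ℝ ≃ₜ Space 1 :=
    (Homeomorph.funUnique (Fin 1) ℝ).symm.trans (PiLp.homeomorph 2 (fun _ : Fin 1 => ℝ)).symm
  have he : MeasurePreserving e volume volume :=
    (PiLp.volume_preserving_toLp (Fin 1)).comp (volume_preserving_funUnique (Fin 1) ℝ).symm
  have heq : ∀ t : ℝ, e t = t • EuclideanSpace.single 0 1 := by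
    intro t
    ext i
    fin_cases i
    simp [e]
    rfl
  have hd : ∀ t, HasDerivAt (w ∘ e) (fderiv ℝ w (e t) (EuclideanSpace.single 0 1)) t := by
    intro t
    have h1 : HasDerivAt e (EuclideanSpace.single 0 1) t := by
      have := (hasDerivAt_id t).smul_const (EuclideanSpace.single (0 : Fin 1) (1 : ℝ))
      simp only [one_smul] at this
      exact this.congr_of_eventuallyEq (Eventually.of_forall heq)
    exact ((hw.differentiable one_ne_zero) (e t)).hasFDerivAt.comp_hasDerivAt t h1
  have hwe : ContDiff ℝ 1 (w ∘ e) := by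
    refine hw.comp ?_
    have : (e : ℝ → Space 1) = fun t => t • EuclideanSpace.single 0 1 := funext heq
    rw [this]
    fun_prop
  have h1 := HasCompactSupport.enorm_le_lintegral_Ici_deriv hwe
    (hc.comp_homeomorph e) (e.symm x)
  simp only [Function.comp_apply, Homeomorph.apply_symm_apply] at h1
  calc ‖w x‖ₑ ≤ ∫⁻ y in Iic (e.symm x), ‖deriv (w ∘ e) y‖ₑ := h1
    _ ≤ ∫⁻ y, ‖deriv (w ∘ e) y‖ₑ := setLIntegral_le_lintegral _ _
    _ ≤ ∫⁻ y, ‖fderiv ℝ w (e y)‖ₑ := by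
      refine lintegral_mono fun y => ?_
      rw [(hd y).deriv]
      refine (ContinuousLinearMap.le_opENorm _ _).trans ?_
      have : ‖(EuclideanSpace.single (0 : Fin 1) (1 : ℝ))‖ₑ = 1 := by
        simp [← ofReal_norm]
      rw [this, mul_one]
    _ = ∫⁻ y, ‖fderiv ℝ w y‖ₑ :=
      he.lintegral_comp (hw.continuous_fderiv one_ne_zero).measurable.enorm

theorem support_fderiv_subset_of_tsupport_subset {d : ℕ} {w : Space d → ℝ} {A : Set (Space d)} (h : tsupport w ⊆ A) :
    Function.support (fderiv ℝ w) ⊆ A :=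
  (support_fderiv_subset ℝ).trans h

theorem hasCompactSupport_of_tsupport_subset {d : ℕ} {w : Space d → ℝ} {ρ : ℝ}
    (h : tsupport w ⊆ Metric.closedBall 0 ρ) : HasCompactSupport w :=
  (isCompact_closedBall _ _).of_isClosed_subset (isClosed_tsupport w) h

theorem exists_eLpNorm'_le_fderiv_of_lt {d : ℕ} {p t : ℝ} (hp : 1 ≤ p) (ht : 1 ≤ t)
    (hpd : p < d) (hpt : 1 / p - 1 / d ≤ 1 / t) (ρ : ℝ) :
    ∃ C : ℝ≥0∞, C ≠ ⊤ ∧ ∀ w : Space d → ℝ, ContDiff ℝ 1 w → tsupport w ⊆ Metric.closedBall 0 ρ →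
      eLpNorm' w t volume ≤ C * eLpNorm' (fderiv ℝ w) p volume := by
  lift p to NNReal using by linarith
  lift t to NNReal using by linarith
  have hp0 : p ≠ 0 := by rintro rfl; norm_num at hp
  have ht0 : t ≠ 0 := by rintro rfl; norm_num at ht
  refine ⟨eLpNormLESNormFDerivOfLeConst ℝ volume (Metric.closedBall (0 : Space d) ρ) p t,
    ENNReal.coe_ne_top, fun w hw hs => ?_⟩
  rw [← eLpNorm_nnreal_eq_eLpNorm' hp0, ← eLpNorm_nnreal_eq_eLpNorm' ht0]
  refine eLpNorm_le_eLpNorm_fderiv_of_le volume hw ((subset_tsupport w).trans hs)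
    (by exact_mod_cast hp) (by rw [finrank_euclideanSpace_fin]; exact_mod_cast hpd) ?_
    Metric.isBounded_closedBall
  rw [finrank_euclideanSpace_fin]
  simpa using hpt

/-- The subcritical range p < d is the Sobolev inequality. For p ≥ d one lowers the gradient
exponent, at the cost of a power of the volume of the ball: down to 1 on the line, where the
gradient then bounds the supremum, and down to some r < d in higher dimension. -/
theorem exists_eLpNorm'_le_fderiv {d : ℕ} (hd : 1 ≤ d) {p t : ℝ} (hp : 1 ≤ p) (ht : 1 ≤ t)
    (hpt : 1 / p - 1 / d ≤ 1 / t) (ρ : ℝ) :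
    ∃ C : ℝ≥0∞, C ≠ ⊤ ∧ ∀ w : Space d → ℝ, ContDiff ℝ 1 w → tsupport w ⊆ Metric.closedBall 0 ρ →
      eLpNorm' w t volume ≤ C * eLpNorm' (fderiv ℝ w) p volume := by
  have hB : volume (Metric.closedBall (0 : Space d) ρ) ≠ ⊤ := measure_closedBall_lt_top.ne
  rcases lt_or_ge p d with hpd | hpd
  · exact exists_eLpNorm'_le_fderiv_of_lt hp ht hpd hpt ρ
  rcases hd.eq_or_lt with rfl | hd2
  · refine ⟨volume (Metric.closedBall (0 : Space 1) ρ) ^ (1 / (1 : ℝ) - 1 / p) *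
      volume (Metric.closedBall (0 : Space 1) ρ) ^ (1 / t), ?_, fun w hw hs => ?_⟩
    · refine ENNReal.mul_ne_top (ENNReal.rpow_ne_top_of_nonneg ?_ hB)
        (ENNReal.rpow_ne_top_of_nonneg (by positivity) hB)
      rw [sub_nonneg]
      exact one_div_le_one_div_of_le one_pos hp
    have h1 := enorm_le_lintegral_fderiv hw (hasCompactSupport_of_tsupport_subset hs)
    have h2 := eLpNorm'_le_of_support_subset (ν := volume) one_pos hp
      (hw.continuous_fderiv one_ne_zero).aestronglyMeasurable (support_fderiv_subset_of_tsupport_subset hs)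
    have h3 : ∀ x, ‖w x‖ₑ ≤ eLpNorm' (fderiv ℝ w) 1 volume := by
      intro x
      simpa [eLpNorm'] using h1 x
    have h4 : eLpNorm' w t volume ≤ eLpNorm' (fderiv ℝ w) 1 volume *
        volume (Metric.closedBall (0 : Space 1) ρ) ^ (1 / t) := by
      have ht0 : 0 < t := by linarith
      calc eLpNorm' w t volume
          = (∫⁻ x in Metric.closedBall (0 : Space 1) ρ, ‖w x‖ₑ ^ t) ^ (1 / t) := by
            unfold eLpNorm'
            congr 1
            refine (setLIntegral_eq_of_support_subset ?_).symm
            intro x hx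
            refine hs (subset_tsupport w ?_)
            intro h0
            simp [h0, ht0] at hx
        _ ≤ (∫⁻ _ in Metric.closedBall (0 : Space 1) ρ,
              eLpNorm' (fderiv ℝ w) 1 volume ^ t) ^ (1 / t) := by
            gcongr with x
            exact h3 x
        _ = _ := by
            rw [setLIntegral_const, ENNReal.mul_rpow_of_nonneg _ _ (by positivity),
              ← ENNReal.rpow_mul]
            simp [ht0.ne']
    calc _ ≤ _ := h4
      _ ≤ _ := mul_le_mul_left h2 _
      _ = _ := by ring
  · have hd0 : (0 : ℝ) < d := by positivity
    have hd2' : (2 : ℝ) ≤ d := by exact_mod_cast hd2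
    have ht0 : 0 < t := by linarith
    -- The exponent whose Sobolev conjugate is t, or 1 if that exponent would fall below 1; `d ≥ 2`
    -- ensures r < d.
    set r : ℝ := (min 1 (1 / d + 1 / t))⁻¹ with hr
    have hm : 0 < min 1 (1 / (d : ℝ) + 1 / t) := lt_min one_pos (by positivity)
    have hr1 : 1 ≤ r := by
      rw [hr, one_le_inv₀ hm]
      exact min_le_left _ _
    have hrd : r < d := by
      rw [hr, inv_lt_comm₀ hm hd0, lt_min_iff]
      refine ⟨inv_lt_one_of_one_lt₀ (by linarith), ?_⟩
      rw [← one_div]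
      have : 0 < 1 / t := by positivity
      linarith
    have hrt : 1 / r - 1 / d ≤ 1 / t := by
      rw [hr, one_div, inv_inv]
      linarith [min_le_right 1 (1 / (d : ℝ) + 1 / t)]
    obtain ⟨C, hC, h⟩ := exists_eLpNorm'_le_fderiv_of_lt hr1 ht hrd hrt ρ
    have hrp : r ≤ p := hrd.le.trans hpd
    refine ⟨C * volume (Metric.closedBall (0 : Space d) ρ) ^ (1 / r - 1 / p), ?_,
      fun w hw hs => ?_⟩
    · refine ENNReal.mul_ne_top hC (ENNReal.rpow_ne_top_of_nonneg ?_ hB)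
      rw [sub_nonneg]
      exact one_div_le_one_div_of_le (by linarith) hrp
    · have h2 := eLpNorm'_le_of_support_subset (ν := volume) (by linarith : 0 < r) hrp
        (hw.continuous_fderiv one_ne_zero).aestronglyMeasurable (support_fderiv_subset_of_tsupport_subset hs)
      calc _ ≤ _ := h w hw hs
        _ ≤ C * _ := mul_le_mul_right h2 _
        _ = _ := by ring

/-! ### Gagliardo-Nirenberg inequalities on a fixed ball -/

/-- Inserting the second bound into the first leaves X^((1-l)(s-1)) on the right; dividing it out
turns X^s into X^e with e = 1 + l(s-1). Finiteness of X is needed for the division. -/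
theorem rpow_interpolation_absorb {X G N M C : ℝ≥0∞} {s l : ℝ} (hs : 1 ≤ s) (hl₀ : 0 ≤ l)
    (hX : X ≠ ⊤) (h₁ : X ^ s ≤ C * G * M ^ (s - 1))
    (h₂ : M ≤ N ^ l * X ^ (1 - l)) :
    X ≤ C ^ (1 / (1 + l * (s - 1))) * G ^ (1 / (1 + l * (s - 1))) *
      N ^ (1 - 1 / (1 + l * (s - 1))) := by
  rcases eq_or_ne X 0 with rfl | hX0
  · exact zero_le
  set e := 1 + l * (s - 1) with he
  have hs0 : 0 ≤ s - 1 := by linarith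
  have he1 : 1 ≤ e := by nlinarith [mul_nonneg hl₀ hs0]
  have he0 : 0 < e := by linarith
  have h3 : X ^ s ≤ C * G * N ^ (e - 1) * X ^ (s - e) := by
    calc X ^ s ≤ C * G * (N ^ l * X ^ (1 - l)) ^ (s - 1) := h₁.trans (by gcongr)
      _ = _ := by
        rw [ENNReal.mul_rpow_of_nonneg _ _ hs0, ← ENNReal.rpow_mul, ← ENNReal.rpow_mul, ← mul_assoc]
        congr 2 <;> (congr 1; rw [he]; ring)
  have h4 : X ^ e ≤ C * G * N ^ (e - 1) := by
    have h5 : X ^ s = X ^ e * X ^ (s - e) := by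
      rw [← ENNReal.rpow_add _ _ hX0 hX]
      congr 1
      ring
    rw [h5] at h3
    refine (ENNReal.mul_le_mul_iff_left ?_ ?_).mp h3
    · exact (ENNReal.rpow_pos (pos_iff_ne_zero.mpr hX0) hX).ne'
    · exact ENNReal.rpow_ne_top_of_ne_zero hX0 hX
  calc X = (X ^ e) ^ (1 / e) := by rw [← ENNReal.rpow_mul, mul_one_div_cancel he0.ne', ENNReal.rpow_one]
    _ ≤ (C * G * N ^ (e - 1)) ^ (1 / e) := by gcongr
    _ = _ := by
      have : 0 ≤ 1 / e := by positivity
      rw [ENNReal.mul_rpow_of_nonneg _ _ this, ENNReal.mul_rpow_of_nonneg _ _ this,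
        ← ENNReal.rpow_mul]
      congr 2
      field_simp

/-- Substitution gives G the exponent (1-k)/e and N the complementary one. If this exponent is
smaller than a, the surplus power of N is traded for a power of G through the Poincaré-type bound
`hN`. -/
theorem rpow_interpolation_combine {X G N Y C C₁ : ℝ≥0∞} {e k a : ℝ} (he : 1 ≤ e) (hk₀ : 0 ≤ k)
    (hk₁ : k ≤ 1) (ha : (1 - k) / e ≤ a) (ha₁ : a ≤ 1) (hY : Y ≤ N ^ k * X ^ (1 - k))
    (hX : X ≤ C * G ^ (1 / e) * N ^ (1 - 1 / e)) (hN : N ≤ C₁ * G) :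
    Y ≤ C ^ (1 - k) * C₁ ^ (a - (1 - k) / e) * (G ^ a * N ^ (1 - a)) := by
  have he0 : 0 < e := by linarith
  have hk : 0 ≤ 1 - k := by linarith
  have hb : 0 ≤ (1 - k) / e := by positivity
  have hab : 0 ≤ a - (1 - k) / e := by linarith
  have hei : 0 ≤ 1 - 1 / e := by
    rw [sub_nonneg, div_le_one he0]
    exact he
  calc Y ≤ N ^ k * (C * G ^ (1 / e) * N ^ (1 - 1 / e)) ^ (1 - k) := hY.trans (by gcongr)
    _ = C ^ (1 - k) * G ^ ((1 - k) / e) * (N ^ (1 - a) * N ^ (a - (1 - k) / e)) := by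
      rw [ENNReal.mul_rpow_of_nonneg _ _ hk, ENNReal.mul_rpow_of_nonneg _ _ hk,
        ← ENNReal.rpow_mul, ← ENNReal.rpow_mul,
        ← ENNReal.rpow_add_of_nonneg (1 - a) _ (by linarith) hab]
      have : N ^ (1 - a + (a - (1 - k) / e)) = N ^ k * N ^ ((1 - 1 / e) * (1 - k)) := by
        rw [← ENNReal.rpow_add_of_nonneg _ _ hk₀ (by positivity)]
        congr 1
        field_simp
        ring
      rw [this, show 1 / e * (1 - k) = (1 - k) / e by ring]
      ring
    _ ≤ C ^ (1 - k) * G ^ ((1 - k) / e) * (N ^ (1 - a) * (C₁ * G) ^ (a - (1 - k) / e)) := by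
      gcongr
    _ = C ^ (1 - k) * C₁ ^ (a - (1 - k) / e) *
        ((G ^ ((1 - k) / e) * G ^ (a - (1 - k) / e)) * N ^ (1 - a)) := by
      rw [ENNReal.mul_rpow_of_nonneg _ _ hab]
      ring
    _ = _ := by
      rw [← ENNReal.rpow_add_of_nonneg _ _ hb hab]
      congr 4
      ring

/-- The L^1 Sobolev inequality is applied to |w|^s, whose gradient is at most s|w|^(s-1)|∇w|; Hölder
with exponents p' and p splits that product. This gains integrability even when p ≥ d. -/
theorem exists_eLpNorm'_rpow_le {d : ℕ} (hd : 2 ≤ d) {p s : ℝ} (hp : 1 < p) (hs : 1 < s) :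
    ∃ C : ℝ≥0∞, C ≠ ⊤ ∧ ∀ w : Space d → ℝ, ContDiff ℝ 1 w → HasCompactSupport w →
      eLpNorm' w (s * (d / (d - 1))) volume ^ s ≤ C * eLpNorm' (fderiv ℝ w) p volume *
        eLpNorm' w ((s - 1) * (p / (p - 1))) volume ^ (s - 1) := by
  have hd2 : (2 : ℝ) ≤ d := by exact_mod_cast hd
  have hd1 : (0 : ℝ) < d - 1 := by linarith
  let n' : NNReal := NNReal.conjExponent d
  have hn : NNReal.HolderConjugate (Module.finrank ℝ (Space d)) n' := by
    rw [finrank_euclideanSpace_fin]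
    exact .conjExponent (by exact_mod_cast hd)
  have hn' : (n' : ℝ) = d / (d - 1) := by
    have := hn.coe.conjugate_eq
    rw [finrank_euclideanSpace_fin] at this
    simpa using this
  have hs0 : (0 : ℝ) < s := by linarith
  lift s to NNReal using hs0.le
  refine ⟨eLpNormLESNormFDerivOneConst (volume : Measure (Space d)) (d / (d - 1)) * s,
    ENNReal.mul_ne_top ENNReal.coe_ne_top ENNReal.coe_ne_top, fun w hw hc => ?_⟩
  let v : Space d → ℝ := fun x ↦ ‖w x‖ ^ (s : ℝ)
  have hv : ContDiff ℝ 1 v := hw.norm_rpow hs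
  have h2v : HasCompactSupport v := hc.norm.rpow_const hs0.ne'
  have h1 := eLpNorm_le_eLpNorm_fderiv_one volume hv h2v hn
  rw [eLpNorm_nnreal_eq_eLpNorm' hn.symm.pos.ne', hn', eLpNorm_one_eq_lintegral_enorm] at h1
  calc eLpNorm' w (s * (d / (d - 1))) volume ^ (s : ℝ) = eLpNorm' v (d / (d - 1)) volume := by
        unfold eLpNorm'
        rw [← ENNReal.rpow_mul]
        congr 1
        · congr 1
          ext x
          rw [Real.enorm_rpow_of_nonneg (norm_nonneg _) hs0.le, ← ENNReal.rpow_mul, enorm_norm]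
        · field_simp
    _ ≤ _ := h1
    _ ≤ eLpNormLESNormFDerivOneConst (volume : Measure (Space d)) (d / (d - 1)) *
        ∫⁻ x, s * (‖w x‖ₑ ^ ((s : ℝ) - 1) * ‖fderiv ℝ w x‖ₑ) := by
      gcongr with x
      rw [← mul_assoc]
      exact enorm_fderiv_norm_rpow_le (hw.differentiable one_ne_zero) hs
    _ ≤ eLpNormLESNormFDerivOneConst (volume : Measure (Space d)) (d / (d - 1)) *
        (s * (eLpNorm' w ((s - 1) * (p / (p - 1))) volume ^ ((s : ℝ) - 1) *
          eLpNorm' (fderiv ℝ w) p volume)) := by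
      rw [lintegral_const_mul' _ _ ENNReal.coe_ne_top]
      gcongr
      exact lintegral_rpow_mul_fderiv_le hw hp hs
    _ = _ := by ring

/-- The number b = (1-k)/e is the scale-invariant exponent: eliminating t gives s = bD + (1-b)Q.
Since D ≤ 0 < Q, the map x ↦ xD + (1-x)Q is strictly decreasing, and `ha` becomes b ≤ a. -/
theorem scaling_exponent_le {D Q t e k a s : ℝ} (he : 1 ≤ e) (hD : D ≤ 0) (hQ : 0 < Q)
    (ht : e * t = D + (e - 1) * Q) (hs : s = k * Q + (1 - k) * t)
    (ha : a * D + (1 - a) * Q ≤ s) : (1 - k) / e ≤ a := by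
  have he0 : 0 < e := by linarith
  rw [div_le_iff₀ he0]
  have h1 : e * (a * D + (1 - a) * Q) ≤ e * k * Q + (1 - k) * (D + (e - 1) * Q) := by
    rw [← ht]
    calc _ ≤ e * s := mul_le_mul_of_nonneg_left ha he0.le
      _ = _ := by rw [hs]; ring
  have h2 : 0 ≤ (a * e - (1 - k)) * (Q - D) := by linarith
  have h3 : 0 < Q - D := by linarith
  linarith [nonneg_of_mul_nonneg_left h2 h3]

theorem eLpNorm'_ne_top_of_hasCompactSupport {d : ℕ} {w : Space d → ℝ} (hw : Continuous w)
    (hc : HasCompactSupport w) {t : ℝ} (ht : 0 < t) : eLpNorm' w t volume ≠ ⊤ := by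
  lift t to NNReal using ht.le
  have ht0 : t ≠ 0 := by rintro rfl; simp at ht
  rw [← eLpNorm_nnreal_eq_eLpNorm' ht0]
  exact (hw.memLp_of_hasCompactSupport hc).eLpNorm_lt_top.ne

/-- Interpolation between the Sobolev conjugate of p, which is 1/D, and q gives the exponent t ≥ τ;
Hölder on the ball descends from t to τ. -/
theorem exists_gagliardoNirenberg_of_lt {d : ℕ} (hd : 1 ≤ d) {p q τ a : ℝ} (hp : 1 ≤ p)
    (hq : 1 ≤ q) (hτ : 1 ≤ τ) (ha₀ : 0 < a) (ha₁ : a ≤ 1) (hpd : p < d)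
    (h : a * (1 / p - 1 / d) + (1 - a) * (1 / q) ≤ 1 / τ) (ρ : ℝ) :
    ∃ C : ℝ≥0∞, C ≠ ⊤ ∧ ∀ w : Space d → ℝ, ContDiff ℝ 1 w → tsupport w ⊆ Metric.closedBall 0 ρ →
      eLpNorm' w τ volume ≤
        C * (eLpNorm' (fderiv ℝ w) p volume ^ a * eLpNorm' w q volume ^ (1 - a)) := by
  have hB : volume (Metric.closedBall (0 : Space d) ρ) ≠ ⊤ := measure_closedBall_lt_top.ne
  have hp0 : 0 < p := by linarith
  have hd0 : (0 : ℝ) < d := by linarith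
  have hD : 0 < 1 / p - 1 / d := by
    rw [sub_pos]
    exact one_div_lt_one_div_of_lt hp0 hpd
  set D := 1 / p - 1 / (d : ℝ) with hDdef
  have hD1 : D ≤ 1 := by
    have : 1 / p ≤ 1 := by rw [div_le_one hp0]; exact hp
    have : 0 < 1 / (d : ℝ) := by positivity
    linarith
  have ha : 0 ≤ 1 - a := by linarith
  have hA : 0 < a * D + (1 - a) * (1 / q) := by positivity
  set t := 1 / (a * D + (1 - a) * (1 / q)) with htdef
  have ht : τ ≤ t := by
    rw [htdef, le_div_iff₀ hA]
    calc τ * _ ≤ τ * (1 / τ) := by gcongr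
      _ = 1 := by field_simp
  have hD' : 1 ≤ 1 / D := by rw [le_div_iff₀ hD]; linarith
  obtain ⟨C, hC, hs⟩ := exists_eLpNorm'_le_fderiv hd hp (t := 1 / D) hD' (by
    rw [one_div_one_div]) ρ
  refine ⟨C ^ a * volume (Metric.closedBall (0 : Space d) ρ) ^ (1 / τ - 1 / t), ?_,
    fun w hw hsupp => ?_⟩
  · refine ENNReal.mul_ne_top (ENNReal.rpow_ne_top_of_nonneg ha₀.le hC)
      (ENNReal.rpow_ne_top_of_nonneg ?_ hB)
    rw [sub_nonneg]
    exact one_div_le_one_div_of_le (by linarith) ht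
  · have hm : AEStronglyMeasurable w volume := hw.continuous.aestronglyMeasurable
    have h1 := eLpNorm'_le_of_support_subset (ν := volume) (by linarith : 0 < τ) ht hm
      ((subset_tsupport w).trans hsupp)
    have h2 := eLpNorm'_interpolation (ν := volume) (f := w) (t := t) (t₀ := 1 / D) (t₁ := q)
      (l := a) (by positivity) (by positivity) (by linarith) ha₀.le ha₁ (by
        rw [htdef, one_div_one_div]; field_simp) hm
    calc _ ≤ _ := h1
      _ ≤ (C * eLpNorm' (fderiv ℝ w) p volume) ^ a * eLpNorm' w q volume ^ (1 - a) *
          volume (Metric.closedBall (0 : Space d) ρ) ^ (1 / τ - 1 / t) := by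
        gcongr
        refine h2.trans ?_
        gcongr
        exact hs w hw hsupp
      _ = _ := by
        rw [ENNReal.mul_rpow_of_nonneg _ _ ha₀.le]
        ring

/-- On the line the supremum replaces the high Lebesgue exponent. The fundamental theorem of
calculus for |w|^e, with e chosen so that (e-1)p' = q, bounds the supremum by G^(1/e) N^(1-1/e);
then |w|^τ ≤ |w|^q (sup|w|)^(τ-q). -/
theorem exists_gagliardoNirenberg_line {p q τ a : ℝ} (hp : 1 ≤ p)
    (hq : 1 ≤ q) (hqτ : q < τ) (ha₁ : a ≤ 1)
    (h : a * (1 / p - 1) + (1 - a) * (1 / q) ≤ 1 / τ) (ρ : ℝ) :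
    ∃ C : ℝ≥0∞, C ≠ ⊤ ∧ ∀ w : Space 1 → ℝ, ContDiff ℝ 1 w → tsupport w ⊆ Metric.closedBall 0 ρ →
      eLpNorm' w τ volume ≤
        C * (eLpNorm' (fderiv ℝ w) p volume ^ a * eLpNorm' w q volume ^ (1 - a)) := by
  have hp0 : 0 < p := by linarith
  have hq0 : 0 < q := by linarith
  have hτ0 : 0 < τ := by linarith
  have hp1 : 1 / p ≤ 1 := by rw [div_le_one hp0]; exact hp
  obtain ⟨C₁, hC₁, hN⟩ := exists_eLpNorm'_le_fderiv (d := 1) le_rfl hp hq (by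
    have : 0 < 1 / q := by positivity
    rw [Nat.cast_one]
    linarith) ρ
  set e := 1 + q * (1 - 1 / p) with he
  have he1 : 1 ≤ e := by
    have : 0 ≤ q * (1 - 1 / p) := mul_nonneg hq0.le (by linarith)
    linarith
  have he0 : 0 < e := by linarith
  have hk : q / τ ≤ 1 := by rw [div_le_one hτ0]; exact hqτ.le
  have hk' : 0 ≤ 1 - q / τ := by linarith
  have hb : (1 - q / τ) / e ≤ a := by
    refine scaling_exponent_le (D := 1 / p - 1) (Q := 1 / q) (t := 0) (s := 1 / τ) he1
      (by linarith) (by positivity) ?_ ?_ h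
    · rw [he]; field_simp; ring
    · field_simp; ring
  refine ⟨(ENNReal.ofReal e ^ (1 / e)) ^ (1 - q / τ) * C₁ ^ (a - (1 - q / τ) / e), ?_,
    fun w hw hsupp => ?_⟩
  · exact ENNReal.mul_ne_top (ENNReal.rpow_ne_top_of_nonneg hk'
      (ENNReal.rpow_ne_top_of_nonneg (by positivity) ENNReal.ofReal_ne_top))
      (ENNReal.rpow_ne_top_of_nonneg (by linarith) hC₁)
  have hc := hasCompactSupport_of_tsupport_subset hsupp
  have hwc := hw.continuous
  set G := eLpNorm' (fderiv ℝ w) p volume with hG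
  set N := eLpNorm' w q volume with hNdef
  have hsup : ∀ x, ‖w x‖ₑ ≤ ENNReal.ofReal e ^ (1 / e) * G ^ (1 / e) * N ^ (1 - 1 / e) := by
    intro x
    rcases hp.eq_or_lt with rfl | hp1
    -- For p = 1 the power degenerates to e = 1 and the fundamental theorem applies to w itself.
    · have he' : e = 1 := by rw [he]; norm_num
      have := enorm_le_lintegral_fderiv hw hc x
      simpa [he', hG, eLpNorm'] using this
    · have hes : 1 < e := by
        have : 1 / p < 1 := by rw [div_lt_one hp0]; exact hp1
        have : 0 < q * (1 - 1 / p) := mul_pos hq0 (by linarith)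
        linarith
      have h1 := enorm_le_lintegral_fderiv (hw.norm_rpow hes)
        (hc.norm.rpow_const he0.ne') x
      rw [Real.enorm_rpow_of_nonneg (norm_nonneg _) he0.le, enorm_norm] at h1
      have h2 : ‖w x‖ₑ ^ e ≤ ENNReal.ofReal e * G * N ^ (e - 1) := by
        calc _ ≤ _ := h1
          _ ≤ ∫⁻ y, ENNReal.ofReal e * (‖w y‖ₑ ^ (e - 1) * ‖fderiv ℝ w y‖ₑ) := by
            gcongr with y
            rw [← mul_assoc]
            have := enorm_fderiv_norm_rpow_le (x := y) (p := e.toNNReal)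
              (hw.differentiable one_ne_zero) (by simpa using hes)
            rwa [Real.coe_toNNReal _ he0.le] at this
          _ ≤ ENNReal.ofReal e * (N ^ (e - 1) * G) := by
            rw [lintegral_const_mul' _ _ ENNReal.ofReal_ne_top]
            gcongr
            have := lintegral_rpow_mul_fderiv_le hw hp1 hes
            have hpe : (e - 1) * (p / (p - 1)) = q := by
              have : p - 1 ≠ 0 := by linarith
              rw [he]; field_simp; ring
            rwa [hpe] at this
          _ = _ := by ring
      calc ‖w x‖ₑ = (‖w x‖ₑ ^ e) ^ (1 / e) := by
            rw [← ENNReal.rpow_mul, mul_one_div_cancel he0.ne', ENNReal.rpow_one]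
        _ ≤ (ENNReal.ofReal e * G * N ^ (e - 1)) ^ (1 / e) := by gcongr
        _ = _ := by
          have : 0 ≤ 1 / e := by positivity
          rw [ENNReal.mul_rpow_of_nonneg _ _ this, ENNReal.mul_rpow_of_nonneg _ _ this,
            ← ENNReal.rpow_mul]
          congr 2
          field_simp
  set X := ENNReal.ofReal e ^ (1 / e) * G ^ (1 / e) * N ^ (1 - 1 / e) with hX
  refine rpow_interpolation_combine (X := X) he1 (by positivity) hk hb ha₁ ?_ le_rfl
    (hN w hw hsupp)
  calc eLpNorm' w τ volume ≤ (∫⁻ x, ‖w x‖ₑ ^ q * X ^ (τ - q)) ^ (1 / τ) := by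
        unfold eLpNorm'
        gcongr with x
        calc ‖w x‖ₑ ^ τ = ‖w x‖ₑ ^ q * ‖w x‖ₑ ^ (τ - q) := by
              rw [← ENNReal.rpow_add_of_nonneg _ _ hq0.le (by linarith)]
              congr 1
              ring
          _ ≤ _ := by
            gcongr
            exact hsup x
    _ = _ := by
      rw [lintegral_mul_const _ (by fun_prop),
        ENNReal.mul_rpow_of_nonneg _ _ (by positivity), hNdef, eLpNorm', ← ENNReal.rpow_mul,
        ← ENNReal.rpow_mul]
      congr 2 <;> field_simp

/-- Sobolev for a power of |w| bounds a high norm L^T by the gradient and an intermediate norm L^m.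
Interpolating L^m between L^q and L^T absorbs it, and interpolating L^τ between the same two gives
the claim. -/
theorem exists_gagliardoNirenberg_of_ge {d : ℕ} (hd : 2 ≤ d) {p q τ a : ℝ} (hpd : d ≤ p)
    (hq : 1 ≤ q) (hqτ : q < τ) (ha₁ : a ≤ 1)
    (h : a * (1 / p - 1 / d) + (1 - a) * (1 / q) ≤ 1 / τ) (ρ : ℝ) :
    ∃ C : ℝ≥0∞, C ≠ ⊤ ∧ ∀ w : Space d → ℝ, ContDiff ℝ 1 w → tsupport w ⊆ Metric.closedBall 0 ρ →
      eLpNorm' w τ volume ≤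
        C * (eLpNorm' (fderiv ℝ w) p volume ^ a * eLpNorm' w q volume ^ (1 - a)) := by
  have hd2 : (2 : ℝ) ≤ d := by exact_mod_cast hd
  have hd1 : (0 : ℝ) < d - 1 := by linarith
  have hp1 : 0 < p - 1 := by linarith
  have hp0 : 0 < p := by linarith
  have hd0 : (0 : ℝ) < d := by linarith
  have hq0 : 0 < q := by linarith
  have hτ0 : 0 < τ := by linarith
  have hD : 1 / p - 1 / (d : ℝ) ≤ 0 := by
    rw [sub_nonpos]
    exact one_div_le_one_div_of_le hd0 hpd
  obtain ⟨C₁, hC₁, hN⟩ := exists_eLpNorm'_le_fderiv (d := d) (by omega) (by linarith : 1 ≤ p) hq (by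
    have : 0 < 1 / q := by positivity
    linarith) ρ
  -- With this choice m = τp' > τ > q and T > τ, so both L^m and L^τ lie between L^q and L^T.
  set s := 1 + τ with hs
  have hs1 : 1 < s := by linarith
  set T := s * (d / (d - 1)) with hT
  set m := (s - 1) * (p / (p - 1)) with hm
  have hqm : q < m := by
    rw [hm, hs, mul_div_assoc', lt_div_iff₀ hp1]
    nlinarith
  have hmT : m < T := by
    have h1 : p / (p - 1) ≤ d / (d - 1) := by
      rw [div_le_div_iff₀ hp1 hd1]
      nlinarith
    have h2 : 0 < (d : ℝ) / (d - 1) := by positivity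
    calc m ≤ (s - 1) * (d / (d - 1)) := by
          rw [hm]
          exact mul_le_mul_of_nonneg_left h1 (by linarith)
      _ < T := by rw [hT]; nlinarith
  have hτT : τ < T := by
    rw [hT, hs, mul_div_assoc', lt_div_iff₀ hd1]
    nlinarith
  have hm0 : 0 < m := by linarith
  have hT0 : 0 < T := by linarith
  have hden : 0 < 1 / q - 1 / T := by
    rw [sub_pos]
    exact one_div_lt_one_div_of_lt hq0 (by linarith)
  set l := (1 / m - 1 / T) / (1 / q - 1 / T) with hl
  set k := (1 / τ - 1 / T) / (1 / q - 1 / T) with hk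
  have hl0 : 0 ≤ l := by
    refine div_nonneg ?_ hden.le
    rw [sub_nonneg]
    exact one_div_le_one_div_of_le hm0 hmT.le
  have hl1 : l ≤ 1 := by
    rw [hl, div_le_one hden]
    linarith [one_div_le_one_div_of_le hq0 hqm.le]
  have hk0 : 0 ≤ k := by
    refine div_nonneg ?_ hden.le
    rw [sub_nonneg]
    exact one_div_le_one_div_of_le hτ0 hτT.le
  have hk1 : k ≤ 1 := by
    rw [hk, div_le_one hden]
    linarith [one_div_le_one_div_of_le hq0 hqτ.le]
  have hleq : 1 / m = l * (1 / q) + (1 - l) * (1 / T) := by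
    have : l * (1 / q - 1 / T) = 1 / m - 1 / T := div_mul_cancel₀ _ hden.ne'
    linarith
  have hkeq : 1 / τ = k * (1 / q) + (1 - k) * (1 / T) := by
    have : k * (1 / q - 1 / T) = 1 / τ - 1 / T := div_mul_cancel₀ _ hden.ne'
    linarith
  set e := 1 + l * (s - 1) with he
  have he1 : 1 ≤ e := by
    have : 0 ≤ l * (s - 1) := mul_nonneg hl0 (by linarith)
    linarith
  have hb : (1 - k) / e ≤ a := by
    refine scaling_exponent_le (D := 1 / p - 1 / d) (Q := 1 / q) (t := 1 / T) (s := 1 / τ) he1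
      hD (by positivity) ?_ hkeq h
    -- Subtracting the two identities for s/T and (s-1)/m gives the relation e/T = D + (e-1)/q
    -- required of the scale-invariant exponent.
    have h1 : s * (1 / T) = 1 - 1 / d := by
      rw [hT]; field_simp
    have h2 : (s - 1) * (1 / m) = 1 - 1 / p := by
      have : s - 1 ≠ 0 := by linarith
      rw [hm]; field_simp
    rw [hleq] at h2
    rw [he]
    linear_combination h1 - h2
  obtain ⟨C, hC, hS⟩ := exists_eLpNorm'_rpow_le hd (by linarith : 1 < p) hs1
  refine ⟨(C ^ (1 / e)) ^ (1 - k) * C₁ ^ (a - (1 - k) / e), ?_, fun w hw hsupp => ?_⟩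
  · exact ENNReal.mul_ne_top (ENNReal.rpow_ne_top_of_nonneg (by linarith)
      (ENNReal.rpow_ne_top_of_nonneg (by positivity) hC))
      (ENNReal.rpow_ne_top_of_nonneg (by linarith) hC₁)
  have hc := hasCompactSupport_of_tsupport_subset hsupp
  have hwm : AEStronglyMeasurable w volume := hw.continuous.aestronglyMeasurable
  refine rpow_interpolation_combine (X := eLpNorm' w T volume) he1 hk0 hk1 hb ha₁ ?_ ?_
    (hN w hw hsupp)
  · exact eLpNorm'_interpolation hτ0 hq0 hT0 hk0 hk1 (by rw [hkeq]; ring) hwm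
  · exact rpow_interpolation_absorb hs1.le hl0
      (eLpNorm'_ne_top_of_hasCompactSupport hw.continuous hc hT0) (hS w hw hc)
      (eLpNorm'_interpolation hm0 hq0 hT0 hl0 hl1 (by rw [hleq]; ring) hwm)

/-- The Gagliardo-Nirenberg inequality for functions supported in a fixed ball. -/
theorem exists_gagliardoNirenberg {d : ℕ} (hd : 1 ≤ d) {p q τ a : ℝ} (hp : 1 ≤ p)
    (hq : 1 ≤ q) (hτ : 1 ≤ τ) (ha₀ : 0 < a) (ha₁ : a ≤ 1)
    (h : a * (1 / p - 1 / d) + (1 - a) * (1 / q) ≤ 1 / τ) (ρ : ℝ) :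
    ∃ C : ℝ≥0∞, C ≠ ⊤ ∧ ∀ w : Space d → ℝ, ContDiff ℝ 1 w → tsupport w ⊆ Metric.closedBall 0 ρ →
      eLpNorm' w τ volume ≤
        C * (eLpNorm' (fderiv ℝ w) p volume ^ a * eLpNorm' w q volume ^ (1 - a)) := by
  rcases lt_or_ge p d with hpd | hpd
  · exact exists_gagliardoNirenberg_of_lt hd hp hq hτ ha₀ ha₁ hpd h ρ
  rcases lt_or_ge q τ with hqτ | hqτ
  · rcases hd.eq_or_lt with rfl | hd2
    · exact exists_gagliardoNirenberg_line hp hq hqτ ha₁ (by simpa using h) ρ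
    · exact exists_gagliardoNirenberg_of_ge hd2 hpd hq hqτ ha₁ h ρ
  have hd0 : (0 : ℝ) < d := by positivity
  have hB : volume (Metric.closedBall (0 : Space d) ρ) ≠ ⊤ := measure_closedBall_lt_top.ne
  -- Remaining case p ≥ d and τ ≤ q: Hölder passes from τ to q, and only the fraction a of the L^q
  -- norm is replaced by the gradient.
  obtain ⟨C₁, hC₁, hN⟩ := exists_eLpNorm'_le_fderiv hd hp hq (by
    have : 0 < 1 / q := by positivity
    linarith [one_div_le_one_div_of_le hd0 hpd]) ρ
  refine ⟨C₁ ^ a * volume (Metric.closedBall (0 : Space d) ρ) ^ (1 / τ - 1 / q), ?_,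
    fun w hw hsupp => ?_⟩
  · refine ENNReal.mul_ne_top (ENNReal.rpow_ne_top_of_nonneg ha₀.le hC₁)
      (ENNReal.rpow_ne_top_of_nonneg ?_ hB)
    rw [sub_nonneg]
    exact one_div_le_one_div_of_le (by linarith) hqτ
  have h1 := eLpNorm'_le_of_support_subset (ν := volume) (by linarith : 0 < τ) hqτ
    hw.continuous.aestronglyMeasurable ((subset_tsupport w).trans hsupp)
  calc _ ≤ _ := h1
    _ = eLpNorm' w q volume ^ a * eLpNorm' w q volume ^ (1 - a) *
        volume (Metric.closedBall (0 : Space d) ρ) ^ (1 / τ - 1 / q) := by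
      rw [← ENNReal.rpow_add_of_nonneg _ _ ha₀.le (by linarith), add_sub_cancel, ENNReal.rpow_one]
    _ ≤ (C₁ * eLpNorm' (fderiv ℝ w) p volume) ^ a * eLpNorm' w q volume ^ (1 - a) *
        volume (Metric.closedBall (0 : Space d) ρ) ^ (1 / τ - 1 / q) := by
      gcongr
      exact hN w hw hsupp
    _ = _ := by
      rw [ENNReal.mul_rpow_of_nonneg _ _ ha₀.le]
      ring

/-! ### Spherical shells and their dilations -/

/-- The spherical shell `{r ≤ |x| < s}`. -/
def annulus {d : ℕ} (r s : ℝ) : Set (Space d) := {x | r ≤ ‖x‖ ∧ ‖x‖ < s}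

theorem mem_annulus {d : ℕ} {r s : ℝ} {x : Space d} : x ∈ annulus r s ↔ r ≤ ‖x‖ ∧ ‖x‖ < s :=
  Iff.rfl

theorem measurableSet_annulus {d : ℕ} (r s : ℝ) : MeasurableSet (annulus r s : Set (Space d)) :=
  (measurableSet_le measurable_const measurable_norm).inter
    (measurableSet_lt measurable_norm measurable_const)

theorem annulus_subset {d : ℕ} {r s r' s' : ℝ} (hr : r' ≤ r) (hs : s ≤ s') :
    (annulus r s : Set (Space d)) ⊆ annulus r' s' :=
  fun _ hx => ⟨hr.trans hx.1, hx.2.trans_le hs⟩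

theorem smul_mem_annulus_iff {d : ℕ} {t r s : ℝ} (ht : 0 < t) {x : Space d} :
    t • x ∈ (annulus (t * r) (t * s) : Set (Space d)) ↔ x ∈ (annulus r s : Set (Space d)) := by
  simp only [mem_annulus, norm_smul, Real.norm_of_nonneg ht.le]
  rw [mul_le_mul_iff_right₀ ht, mul_lt_mul_iff_right₀ ht]

theorem lintegral_comp_smul {d : ℕ} (h : Space d → ℝ≥0∞) {t : ℝ} (ht : 0 < t) :
    ∫⁻ x, h (t • x) = ENNReal.ofReal (t ^ d)⁻¹ * ∫⁻ x, h x := by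
  have e : MeasurableEmbedding (fun x : Space d => t • x) :=
    (Homeomorph.smulOfNeZero t ht.ne').measurableEmbedding
  rw [← e.lintegral_map h, Measure.map_addHaar_smul _ ht.ne', lintegral_smul_measure,
    finrank_euclideanSpace_fin, abs_of_pos (by positivity), smul_eq_mul]

theorem setLIntegral_annulus_comp_smul {d : ℕ} (h : Space d → ℝ≥0∞) {t : ℝ} (ht : 0 < t)
    (r s : ℝ) : ∫⁻ x in annulus r s, h (t • x) =
      ENNReal.ofReal (t ^ d)⁻¹ * ∫⁻ x in annulus (t * r) (t * s), h x := by
  rw [← lintegral_indicator (measurableSet_annulus _ _),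
    ← lintegral_indicator (measurableSet_annulus _ _), ← lintegral_comp_smul _ ht]
  congr 1
  ext x
  by_cases hx : x ∈ (annulus r s : Set (Space d))
  · rw [indicator_of_mem hx, indicator_of_mem ((smul_mem_annulus_iff ht).mpr hx)]
  · rw [indicator_of_notMem hx, indicator_of_notMem (mt (smul_mem_annulus_iff ht).mp hx)]

theorem setLIntegral_annulus_comp_smul_le {d : ℕ} (h : Space d → ℝ≥0∞) {t r s r' s' : ℝ}
    (ht : 1 ≤ t) (hr : r' ≤ t * r) (hs : t * s ≤ s') :
    ∫⁻ x in annulus r s, h (t • x) ≤ ∫⁻ x in annulus r' s', h x := by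
  rw [setLIntegral_annulus_comp_smul h (by linarith)]
  calc _ ≤ 1 * ∫⁻ x in annulus (t * r) (t * s), h x := by
        gcongr
        rw [ENNReal.ofReal_le_one]
        exact inv_le_one_of_one_le₀ (one_le_pow₀ ht)
    _ ≤ _ := by
        rw [one_mul]
        exact lintegral_mono_set (annulus_subset hr hs)

/-! ### Dilation differences of smooth functions on a shell -/

theorem lintegral_rpow_le_of_isProbabilityMeasure {X : Type*} [MeasurableSpace X] {ν : Measure X}
    [IsProbabilityMeasure ν] {h : X → ℝ≥0∞} (hh : AEMeasurable h ν) {p : ℝ} (hp : 1 ≤ p) :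
    (∫⁻ x, h x ∂ν) ^ p ≤ ∫⁻ x, h x ^ p ∂ν := by
  have hp0 : 0 < p := by linarith
  have := ENNReal.lintegral_mul_norm_pow_le (μ := ν) (f := fun x => h x ^ p) (g := fun _ => 1)
    (hh.pow_const _) aemeasurable_const (p := 1 / p) (q := 1 - 1 / p) (by positivity)
    (by rw [sub_nonneg, div_le_one hp0]; exact hp) (by ring)
  simp only [ENNReal.one_rpow, mul_one, lintegral_one, measure_univ, ← ENNReal.rpow_mul,
    mul_one_div_cancel hp0.ne', ENNReal.rpow_one] at this
  calc _ ≤ ((∫⁻ x, h x ^ p ∂ν) ^ (1 / p)) ^ p := by gcongr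
    _ = _ := by rw [← ENNReal.rpow_mul, one_div_mul_cancel hp0.ne', ENNReal.rpow_one]

theorem enorm_sub_dilate_le {d : ℕ} {f : Space d → ℝ} (hf : ContDiff ℝ 1 f) (x : Space d) :
    ‖f x - f ((2 : ℝ) • x)‖ₑ ≤ ∫⁻ t in Ioc (1 : ℝ) 2, ‖x‖ₑ * ‖fderiv ℝ f (t • x)‖ₑ := by
  have hd : ∀ t : ℝ, HasDerivAt (fun t : ℝ => f (t • x)) (fderiv ℝ f (t • x) x) t := by
    intro t
    have h1 : HasDerivAt (fun t : ℝ => t • x) x t := by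
      simpa using (hasDerivAt_id t).smul_const x
    exact ((hf.differentiable one_ne_zero) (t • x)).hasFDerivAt.comp_hasDerivAt t h1
  have hc : Continuous fun t : ℝ => fderiv ℝ f (t • x) x := by
    have := hf.continuous_fderiv one_ne_zero
    fun_prop
  have h1 := intervalIntegral.integral_eq_sub_of_hasDerivAt (a := 1) (b := 2)
    (fun t _ => hd t) (hc.intervalIntegrable _ _)
  rw [one_smul] at h1
  rw [← enorm_neg, neg_sub, ← h1, intervalIntegral.integral_of_le (by norm_num)]
  refine (enorm_integral_le_lintegral_enorm _).trans (lintegral_mono fun t => ?_)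
  rw [mul_comm]
  exact ContinuousLinearMap.le_opENorm _ _

/-- The difference is the integral of the derivative along t ↦ tx for t in [1,2]. Jensen on this
unit interval and Fubini reduce the bound to dilates of the gradient, all of whose arguments stay in
the shell from 1/2 to 8; the factor 4 bounds |x|. -/
theorem eLpNorm'_sub_dilate_le {d : ℕ} {f : Space d → ℝ} (hf : ContDiff ℝ 1 f) {p : ℝ}
    (hp : 1 ≤ p) :
    eLpNorm' (fun x => f x - f ((2 : ℝ) • x)) p (volume.restrict (annulus (1 / 2) 4)) ≤
      4 * eLpNorm' (fderiv ℝ f) p (volume.restrict (annulus (1 / 2) 8)) := by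
  have hp0 : 0 < p := by linarith
  have hc : Continuous (fderiv ℝ f) := hf.continuous_fderiv one_ne_zero
  have : IsProbabilityMeasure (volume.restrict (Ioc (1 : ℝ) 2)) :=
    ⟨by rw [Measure.restrict_apply_univ, Real.volume_Ioc]; norm_num⟩
  have h1 : ∀ x ∈ (annulus (1 / 2) 4 : Set (Space d)), ‖f x - f ((2 : ℝ) • x)‖ₑ ^ p ≤
      4 ^ p * ∫⁻ t in Ioc (1 : ℝ) 2, ‖fderiv ℝ f (t • x)‖ₑ ^ p := by
    intro x hx
    have hx4 : ‖x‖ₑ ≤ 4 := by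
      rw [← ofReal_norm]
      exact ENNReal.ofReal_le_of_le_toReal (by simpa using hx.2.le)
    calc _ ≤ (∫⁻ t in Ioc (1 : ℝ) 2, ‖x‖ₑ * ‖fderiv ℝ f (t • x)‖ₑ) ^ p := by
          gcongr
          exact enorm_sub_dilate_le hf x
      _ ≤ (4 * ∫⁻ t in Ioc (1 : ℝ) 2, ‖fderiv ℝ f (t • x)‖ₑ) ^ p := by
          rw [lintegral_const_mul' _ _ enorm_ne_top]
          gcongr
      _ ≤ _ := by
          rw [ENNReal.mul_rpow_of_nonneg _ _ hp0.le]
          gcongr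
          exact lintegral_rpow_le_of_isProbabilityMeasure
            (by fun_prop : Measurable fun t : ℝ => ‖fderiv ℝ f (t • x)‖ₑ).aemeasurable hp
  have h2 : ∫⁻ x in annulus (1 / 2) 4, ‖f x - f ((2 : ℝ) • x)‖ₑ ^ p ≤
      4 ^ p * ∫⁻ x in (annulus (1 / 2) 8 : Set (Space d)), ‖fderiv ℝ f x‖ₑ ^ p := by
    calc _ ≤ ∫⁻ x in (annulus (1 / 2) 4 : Set (Space d)),
          4 ^ p * ∫⁻ t in Ioc (1 : ℝ) 2, ‖fderiv ℝ f (t • x)‖ₑ ^ p :=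
          setLIntegral_mono' (measurableSet_annulus _ _) h1
      _ = 4 ^ p * ∫⁻ t in Ioc (1 : ℝ) 2, ∫⁻ x in (annulus (1 / 2) 4 : Set (Space d)),
            ‖fderiv ℝ f (t • x)‖ₑ ^ p := by
          rw [lintegral_const_mul' _ _ (by finiteness), lintegral_lintegral_swap]
          have : Continuous fun z : Space d × ℝ => fderiv ℝ f (z.2 • z.1) := by fun_prop
          exact (this.enorm.measurable.pow_const p).aemeasurable
      _ ≤ 4 ^ p * ∫⁻ t in Ioc (1 : ℝ) 2, ∫⁻ x in (annulus (1 / 2) 8 : Set (Space d)),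
            ‖fderiv ℝ f x‖ₑ ^ p := by
          gcongr 4 ^ p * ?_
          refine setLIntegral_mono' measurableSet_Ioc fun t ht => ?_
          exact setLIntegral_annulus_comp_smul_le (fun x => ‖fderiv ℝ f x‖ₑ ^ p) ht.1.le
            (by linarith [ht.1]) (by linarith [ht.2])
      _ = _ := by
          rw [lintegral_const, measure_univ, mul_one]
  unfold eLpNorm'
  calc _ ≤ (4 ^ p * ∫⁻ x in (annulus (1 / 2) 8 : Set (Space d)), ‖fderiv ℝ f x‖ₑ ^ p) ^ (1 / p) := by
        gcongr
    _ = _ := by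
        rw [ENNReal.mul_rpow_of_nonneg _ _ (by positivity), ← ENNReal.rpow_mul,
          mul_one_div_cancel hp0.ne', ENNReal.rpow_one]

/-- A smooth cutoff equal to `1` on `{1 ≤ |x| < 2}`. -/
noncomputable def shellCutoff {d : ℕ} (x : Space d) : ℝ :=
  Real.smoothTransition (2 * ‖x‖ ^ 2 - 1) * Real.smoothTransition (9 - ‖x‖ ^ 2)

theorem contDiff_shellCutoff {d : ℕ} : ContDiff ℝ 1 (shellCutoff : Space d → ℝ) := by
  have h := Real.smoothTransition.contDiff (n := 1)
  have h1 : ContDiff ℝ 1 fun x : Space d => ‖x‖ ^ 2 := contDiff_norm_sq ℝ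
  exact (h.comp ((contDiff_const.mul h1).sub contDiff_const)).mul (h.comp (contDiff_const.sub h1))

theorem shellCutoff_eq_one {d : ℕ} {x : Space d} (hx : x ∈ (annulus 1 2 : Set (Space d))) :
    shellCutoff x = 1 := by
  have h1 := hx.1
  have h2 := hx.2
  rw [shellCutoff, Real.smoothTransition.one_of_one_le (by nlinarith),
    Real.smoothTransition.one_of_one_le (by nlinarith), one_mul]

theorem abs_shellCutoff_le_one {d : ℕ} (x : Space d) : |shellCutoff x| ≤ 1 := by
  rw [shellCutoff, abs_of_nonneg (mul_nonneg (Real.smoothTransition.nonneg _)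
    (Real.smoothTransition.nonneg _))]
  exact mul_le_one₀ (Real.smoothTransition.le_one _) (Real.smoothTransition.nonneg _)
    (Real.smoothTransition.le_one _)

theorem tsupport_shellCutoff_subset {d : ℕ} :
    tsupport (shellCutoff : Space d → ℝ) ⊆ annulus (1 / 2) 4 := by
  have h1 : tsupport (shellCutoff : Space d → ℝ) ⊆
      {x | 1 ≤ 2 * ‖x‖ ^ 2} ∩ {x | ‖x‖ ^ 2 ≤ 9} := by
    refine closure_minimal ?_ ((isClosed_le (by fun_prop) (by fun_prop)).inter
      (isClosed_le (by fun_prop) (by fun_prop)))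
    intro x hx
    constructor
    · by_contra h
      simp only [mem_ofPred_eq, not_le] at h
      exact hx (by rw [shellCutoff, Real.smoothTransition.zero_of_nonpos (by linarith), zero_mul])
    · by_contra h
      simp only [mem_ofPred_eq, not_le] at h
      exact hx (by
        rw [shellCutoff, Real.smoothTransition.zero_of_nonpos (x := 9 - ‖x‖ ^ 2) (by linarith),
          mul_zero])
  intro x hx
  obtain ⟨h2, h3⟩ := h1 hx
  simp only [mem_ofPred_eq] at h2 h3
  have := norm_nonneg x
  constructor <;> nlinarith

theorem eLpNorm'_volume_le_of_enorm_le {d : ℕ} {F F' : Type*} [NormedAddCommGroup F]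
    [NormedAddCommGroup F'] {g : Space d → F} {h : Space d → F'} {A : Set (Space d)} {p : ℝ}
    (hp : 0 < p) (hA : MeasurableSet A) (h₀ : Function.support g ⊆ A)
    (h₁ : ∀ x ∈ A, ‖g x‖ₑ ≤ ‖h x‖ₑ) :
    eLpNorm' g p volume ≤ eLpNorm' h p (volume.restrict A) := by
  unfold eLpNorm'
  gcongr ?_ ^ _
  rw [← setLIntegral_eq_of_support_subset (s := A)]
  · refine setLIntegral_mono' hA fun x hx => ?_
    gcongr
    exact h₁ x hx
  · intro x hx
    refine h₀ fun h0 => ?_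
    simp [h0, hp] at hx

theorem eLpNorm'_comp_smul_le {d : ℕ} {F : Type*} [NormedAddCommGroup F] (g : Space d → F)
    {t r s r' s' p : ℝ} (hp : 0 < p) (ht : 1 ≤ t) (hr : r' ≤ t * r) (hs : t * s ≤ s') :
    eLpNorm' (fun x => g (t • x)) p (volume.restrict (annulus r s)) ≤
      eLpNorm' g p (volume.restrict (annulus r' s')) := by
  unfold eLpNorm'
  gcongr ?_ ^ _
  exact setLIntegral_annulus_comp_smul_le (fun x => ‖g x‖ₑ ^ p) ht hr hs

theorem eLpNorm'_comp_smul {d : ℕ} {F : Type*} [NormedAddCommGroup F] (g : Space d → F)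
    {t p : ℝ} (hp : 0 < p) (ht : 0 < t) (r s : ℝ) :
    eLpNorm' (fun x => g (t • x)) p (volume.restrict (annulus r s)) =
      ENNReal.ofReal t ^ (-(d / p)) * eLpNorm' g p (volume.restrict (annulus (t * r) (t * s))) := by
  unfold eLpNorm'
  rw [setLIntegral_annulus_comp_smul (fun x => ‖g x‖ₑ ^ p) ht,
    ENNReal.mul_rpow_of_nonneg _ _ (by positivity)]
  congr 1
  rw [ENNReal.ofReal_inv_of_pos (by positivity), ENNReal.ofReal_pow ht.le, ← ENNReal.rpow_natCast,
    ← ENNReal.rpow_neg, ← ENNReal.rpow_mul]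
  congr 1
  ring

theorem exists_norm_fderiv_shellCutoff_le (d : ℕ) :
    ∃ M : ℝ, 0 ≤ M ∧ ∀ x : Space d, ‖fderiv ℝ (shellCutoff : Space d → ℝ) x‖ ≤ M := by
  have hc : HasCompactSupport (shellCutoff : Space d → ℝ) :=
    hasCompactSupport_of_tsupport_subset (ρ := 4) fun x hx => by
      simpa using (tsupport_shellCutoff_subset hx).2.le
  obtain ⟨M, hM⟩ := (contDiff_shellCutoff.continuous_fderiv one_ne_zero).bounded_above_of_compact_support
    (hc.fderiv ℝ)
  exact ⟨M, (norm_nonneg _).trans (hM 0), hM⟩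

/-- Gagliardo-Nirenberg is applied to the cutoff times f - f(2·). The term in which the derivative
falls on the cutoff contains f - f(2·) undifferentiated, and `eLpNorm'_sub_dilate_le` turns it back
into a gradient term. -/
theorem exists_eLpNorm'_sub_dilate_le {d : ℕ} (hd : 1 ≤ d) {p q τ a : ℝ} (hp : 1 ≤ p)
    (hq : 1 ≤ q) (hτ : 1 ≤ τ) (ha₀ : 0 < a) (ha₁ : a ≤ 1)
    (h : a * (1 / p - 1 / d) + (1 - a) * (1 / q) ≤ 1 / τ) :
    ∃ C : ℝ≥0∞, C ≠ ⊤ ∧ ∀ f : Space d → ℝ, ContDiff ℝ 1 f →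
      eLpNorm' (fun x => f x - f ((2 : ℝ) • x)) τ (volume.restrict (annulus 1 2)) ≤
        C * (eLpNorm' (fderiv ℝ f) p (volume.restrict (annulus (1 / 2) 8)) ^ a *
          eLpNorm' f q (volume.restrict (annulus (1 / 2) 8)) ^ (1 - a)) := by
  obtain ⟨C, hC, hGN⟩ := exists_gagliardoNirenberg hd hp hq hτ ha₀ ha₁ h 4
  obtain ⟨M, hM0, hM⟩ := exists_norm_fderiv_shellCutoff_le d
  have hp0 : 0 < p := by linarith
  have hq0 : 0 < q := by linarith
  have ha : 0 ≤ 1 - a := by linarith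
  refine ⟨C * ((3 + ENNReal.ofReal M * 4) ^ a * 2 ^ (1 - a)), ?_, fun f hf => ?_⟩
  · refine ENNReal.mul_ne_top hC (ENNReal.mul_ne_top
      (ENNReal.rpow_ne_top_of_nonneg ha₀.le (by finiteness))
      (ENNReal.rpow_ne_top_of_nonneg ha (by finiteness)))
  set v : Space d → ℝ := fun x => f x - f ((2 : ℝ) • x) with hv
  have hvc : ContDiff ℝ 1 v := hf.sub (hf.comp (contDiff_const_smul 2))
  set w : Space d → ℝ := fun x => shellCutoff x * v x with hw
  have hwc : ContDiff ℝ 1 w := contDiff_shellCutoff.mul hvc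
  have hws : tsupport w ⊆ annulus (1 / 2) 4 :=
    (tsupport_mul_subset_left).trans tsupport_shellCutoff_subset
  have hfc : Continuous (fderiv ℝ f) := hf.continuous_fderiv one_ne_zero
  have hA := measurableSet_annulus (d := d) (1 / 2) 4
  have h1 : eLpNorm' v τ (volume.restrict (annulus 1 2)) ≤ eLpNorm' w τ volume := by
    calc _ = eLpNorm' w τ (volume.restrict (annulus 1 2)) := by
          refine eLpNorm'_congr_ae ?_
          filter_upwards [ae_restrict_mem (measurableSet_annulus 1 2)] with x hx
          rw [hw]
          simp [shellCutoff_eq_one hx]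
      _ ≤ _ := eLpNorm'_mono_measure _ Measure.restrict_le_self (by linarith)
  have h2 : eLpNorm' w q volume ≤ 2 * eLpNorm' f q (volume.restrict (annulus (1 / 2) 8)) := by
    calc eLpNorm' w q volume ≤ eLpNorm' v q (volume.restrict (annulus (1 / 2) 4)) := by
          refine eLpNorm'_volume_le_of_enorm_le hq0 hA ((subset_tsupport w).trans hws)
            fun x _ => ?_
          rw [enorm_le_iff_norm_le, hw, norm_mul]
          exact mul_le_of_le_one_left (norm_nonneg _) (abs_shellCutoff_le_one x)
      _ ≤ eLpNorm' f q (volume.restrict (annulus (1 / 2) 4)) +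
          eLpNorm' (fun x => - f ((2 : ℝ) • x)) q (volume.restrict (annulus (1 / 2) 4)) := by
          have hfm := hf.continuous
          have : v = f + fun x => - f ((2 : ℝ) • x) := by
            ext x
            simp [hv, sub_eq_add_neg]
          rw [this]
          exact eLpNorm'_add_le hfm.aestronglyMeasurable
            (by fun_prop : Continuous fun x => - f ((2 : ℝ) • x)).aestronglyMeasurable hq
      _ ≤ eLpNorm' f q (volume.restrict (annulus (1 / 2) 8)) +
          eLpNorm' f q (volume.restrict (annulus (1 / 2) 8)) := by
          gcongr ?_ + ?_
          · exact eLpNorm'_mono_measure _ (Measure.restrict_mono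
              (annulus_subset le_rfl (by norm_num)) le_rfl) hq0.le
          · calc _ = eLpNorm' (fun x => f ((2 : ℝ) • x)) q
                  (volume.restrict (annulus (1 / 2) 4)) := by simp [eLpNorm']
              _ ≤ _ := eLpNorm'_comp_smul_le f hq0 (by norm_num) (by norm_num) (by norm_num)
      _ = _ := by ring
  have h3 : eLpNorm' (fderiv ℝ w) p volume ≤ (3 + ENNReal.ofReal M * 4) *
      eLpNorm' (fderiv ℝ f) p (volume.restrict (annulus (1 / 2) 8)) := by
    have hfd : ∀ x, ‖fderiv ℝ w x‖ ≤
        ‖fderiv ℝ f x‖ + (2 * ‖fderiv ℝ f ((2 : ℝ) • x)‖ + M * ‖v x‖) := by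
      intro x
      have e1 : HasFDerivAt f (fderiv ℝ f x) x := (hf.differentiable one_ne_zero x).hasFDerivAt
      have e2 : HasFDerivAt (fun x => f ((2 : ℝ) • x)) ((2 : ℝ) • fderiv ℝ f ((2 : ℝ) • x)) x := by
        have := (hf.differentiable one_ne_zero ((2 : ℝ) • x)).hasFDerivAt.comp x
          ((hasFDerivAt_id x).const_smul (2 : ℝ))
        convert! this using 1
        ext y
        simp
      have e3 : HasFDerivAt (shellCutoff : Space d → ℝ) (fderiv ℝ shellCutoff x) x :=
        (contDiff_shellCutoff.differentiable one_ne_zero x).hasFDerivAt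
      have e4 := (e3.mul (e1.sub e2)).fderiv
      have e5 : fderiv ℝ w x = shellCutoff x • (fderiv ℝ f x - (2 : ℝ) • fderiv ℝ f ((2 : ℝ) • x)) +
          v x • fderiv ℝ shellCutoff x := e4
      rw [e5]
      calc _ ≤ |shellCutoff x| * (‖fderiv ℝ f x‖ + 2 * ‖fderiv ℝ f ((2 : ℝ) • x)‖) +
            ‖v x‖ * ‖fderiv ℝ (shellCutoff : Space d → ℝ) x‖ := by
            refine (norm_add_le _ _).trans ?_
            rw [norm_smul, norm_smul, Real.norm_eq_abs (shellCutoff x)]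
            gcongr
            refine (norm_sub_le _ _).trans ?_
            rw [norm_smul]
            simp
        _ ≤ 1 * (‖fderiv ℝ f x‖ + 2 * ‖fderiv ℝ f ((2 : ℝ) • x)‖) + ‖v x‖ * M := by
            gcongr
            · exact abs_shellCutoff_le_one x
            · exact hM x
        _ = _ := by ring
    have hvcont : Continuous v := hvc.continuous
    calc eLpNorm' (fderiv ℝ w) p volume ≤ eLpNorm'
          ((fun x => ‖fderiv ℝ f x‖) + ((fun x => 2 * ‖fderiv ℝ f ((2 : ℝ) • x)‖) +
            fun x => M * ‖v x‖)) p (volume.restrict (annulus (1 / 2) 4)) := by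
          refine eLpNorm'_volume_le_of_enorm_le hp0 hA (support_fderiv_subset_of_tsupport_subset hws) fun x _ => ?_
          rw [enorm_le_iff_norm_le]
          refine (hfd x).trans (le_abs_self _)
      _ ≤ eLpNorm' (fun x => ‖fderiv ℝ f x‖) p (volume.restrict (annulus (1 / 2) 4)) +
          (eLpNorm' (fun x => 2 * ‖fderiv ℝ f ((2 : ℝ) • x)‖) p
              (volume.restrict (annulus (1 / 2) 4)) +
            eLpNorm' (fun x => M * ‖v x‖) p (volume.restrict (annulus (1 / 2) 4))) := by
          have c1 : Continuous fun x => 2 * ‖fderiv ℝ f ((2 : ℝ) • x)‖ := by fun_prop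
          have c2 : Continuous fun x => M * ‖v x‖ := by fun_prop
          refine (eLpNorm'_add_le hfc.norm.aestronglyMeasurable
            (c1.add c2).aestronglyMeasurable hp).trans ?_
          gcongr
          exact eLpNorm'_add_le c1.aestronglyMeasurable c2.aestronglyMeasurable hp
      _ ≤ eLpNorm' (fderiv ℝ f) p (volume.restrict (annulus (1 / 2) 8)) +
          (2 * eLpNorm' (fderiv ℝ f) p (volume.restrict (annulus (1 / 2) 8)) +
            ENNReal.ofReal M * (4 *
              eLpNorm' (fderiv ℝ f) p (volume.restrict (annulus (1 / 2) 8)))) := by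
          gcongr ?_ + (?_ + ?_)
          · rw [eLpNorm'_norm]
            exact eLpNorm'_mono_measure _ (Measure.restrict_mono
              (annulus_subset le_rfl (by norm_num)) le_rfl) hp0.le
          · have := eLpNorm'_const_smul (μ := volume.restrict (annulus (1 / 2) 4))
              (f := fun x => ‖fderiv ℝ f ((2 : ℝ) • x)‖) (2 : ℝ) hp0
            have e : ((2 : ℝ) • fun x => ‖fderiv ℝ f ((2 : ℝ) • x)‖) =
              fun x => 2 * ‖fderiv ℝ f ((2 : ℝ) • x)‖ := rfl
            rw [e] at this
            rw [this, eLpNorm'_norm]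
            gcongr
            · simp [← ofReal_norm]
            · exact eLpNorm'_comp_smul_le _ hp0 (by norm_num) (by norm_num) (by norm_num)
          · have := eLpNorm'_const_smul (μ := volume.restrict (annulus (1 / 2) 4))
              (f := fun x => ‖v x‖) M hp0
            have e : (M • fun x => ‖v x‖) = fun x => M * ‖v x‖ := rfl
            rw [e] at this
            rw [this, eLpNorm'_norm, ← ofReal_norm, Real.norm_of_nonneg hM0]
            gcongr
            exact eLpNorm'_sub_dilate_le hf hp
      _ = _ := by ring
  calc _ ≤ _ := h1
    _ ≤ _ := hGN w hwc (hws.trans fun x hx => by simpa using hx.2.le)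
    _ ≤ C * (((3 + ENNReal.ofReal M * 4) *
      eLpNorm' (fderiv ℝ f) p (volume.restrict (annulus (1 / 2) 8))) ^ a *
        (2 * eLpNorm' f q (volume.restrict (annulus (1 / 2) 8))) ^ (1 - a)) := by gcongr
    _ = _ := by
      rw [ENNReal.mul_rpow_of_nonneg _ _ ha₀.le, ENNReal.mul_rpow_of_nonneg _ _ ha]
      ring

theorem eLpNorm'_fderiv_comp_smul {d : ℕ} (f : Space d → ℝ) {r p : ℝ}
    (hp : 0 < p) (hr : 0 < r) (s t : ℝ) :
    eLpNorm' (fderiv ℝ fun x => f (r • x)) p (volume.restrict (annulus s t)) =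
      ENNReal.ofReal r * (ENNReal.ofReal r ^ (-(d / p)) *
        eLpNorm' (fderiv ℝ f) p (volume.restrict (annulus (r * s) (r * t)))) := by
  have e1 : ∀ x, ‖fderiv ℝ (fun x => f (r • x)) x‖ₑ ^ p =
      ENNReal.ofReal r ^ p * ‖fderiv ℝ f (r • x)‖ₑ ^ p := by
    intro x
    rw [fderiv_comp_smul, enorm_smul, ← ofReal_norm r, Real.norm_of_nonneg hr.le,
      ENNReal.mul_rpow_of_nonneg _ _ hp.le]
  rw [← eLpNorm'_comp_smul (fderiv ℝ f) hp hr]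
  unfold eLpNorm'
  simp_rw [e1]
  rw [lintegral_const_mul' _ _ (by finiteness), ENNReal.mul_rpow_of_nonneg _ _ (by positivity),
    ← ENNReal.rpow_mul, mul_one_div_cancel hp.ne', ENNReal.rpow_one]

/-- Rescaling produces R^(1-x) in front of the gradient and R^(-y) in front of the function, while
the weights want R^α and R^β; the balance says that the total powers of R agree. -/
theorem rpow_scaling_combine {R G N : ℝ≥0∞} (hR0 : R ≠ 0) (hRt : R ≠ ⊤) {a α β x y : ℝ}
    (ha₀ : 0 ≤ a) (ha₁ : a ≤ 1) (hbal : a * (α - 1 + x) + (1 - a) * (β + y) = 0) :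
    (R * (R ^ (-x) * G)) ^ a * (R ^ (-y) * N) ^ (1 - a) =
      (R ^ α * G) ^ a * (R ^ β * N) ^ (1 - a) := by
  have ha : 0 ≤ 1 - a := by linarith
  rw [ENNReal.mul_rpow_of_nonneg _ _ ha₀, ENNReal.mul_rpow_of_nonneg _ _ ha,
    ENNReal.mul_rpow_of_nonneg _ _ ha₀, ENNReal.mul_rpow_of_nonneg _ _ ha,
    ENNReal.mul_rpow_of_nonneg _ _ ha₀, ← ENNReal.rpow_mul, ← ENNReal.rpow_mul,
    ← ENNReal.rpow_mul, ← ENNReal.rpow_mul]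
  calc _ = (R ^ a * R ^ (-x * a) * R ^ (-y * (1 - a))) * (G ^ a * N ^ (1 - a)) := by
        ring
    _ = (R ^ (α * a) * R ^ (β * (1 - a))) * (G ^ a * N ^ (1 - a)) := by
        rw [← ENNReal.rpow_add _ _ hR0 hRt, ← ENNReal.rpow_add _ _ hR0 hRt,
          ← ENNReal.rpow_add _ _ hR0 hRt]
        congr 2
        linear_combination -hbal
    _ = _ := by ring

theorem exists_eLpNorm'_sub_dilate_le_scaled {d : ℕ} (hd : 1 ≤ d) {p q τ a α β : ℝ} (hp : 1 ≤ p)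
    (hq : 1 ≤ q) (hτ : 1 ≤ τ) (ha₀ : 0 < a) (ha₁ : a ≤ 1)
    (h : a * (1 / p - 1 / d) + (1 - a) * (1 / q) ≤ 1 / τ)
    (hbal : a * (α - 1 + d / p) + (1 - a) * (β + d / q) = 0) :
    ∃ C : ℝ≥0∞, C ≠ ⊤ ∧ ∀ f : Space d → ℝ, ContDiff ℝ 1 f → ∀ r : ℝ, 0 < r →
      ENNReal.ofReal r ^ (-(d / τ)) *
          eLpNorm' (fun x => f x - f ((2 : ℝ) • x)) τ (volume.restrict (annulus r (r * 2))) ≤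
        C * ((ENNReal.ofReal r ^ α *
            eLpNorm' (fderiv ℝ f) p (volume.restrict (annulus (r * (1 / 2)) (r * 8)))) ^ a *
          (ENNReal.ofReal r ^ β *
            eLpNorm' f q (volume.restrict (annulus (r * (1 / 2)) (r * 8)))) ^ (1 - a)) := by
  obtain ⟨C, hC, hD⟩ := exists_eLpNorm'_sub_dilate_le hd hp hq hτ ha₀ ha₁ h
  refine ⟨C, hC, fun f hf r hr => ?_⟩
  have hp0 : 0 < p := by linarith
  have h1 := hD (fun x => f (r • x)) (hf.comp (contDiff_const_smul r))
  have e1 : (fun x => f (r • x) - f (r • (2 : ℝ) • x)) =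
      fun x => (fun y => f y - f ((2 : ℝ) • y)) (r • x) := by
    ext x
    rw [smul_comm r (2 : ℝ) x]
  have e2 := eLpNorm'_comp_smul (fun y => f y - f ((2 : ℝ) • y)) (by linarith : 0 < τ) hr 1 2
  have e3 := eLpNorm'_fderiv_comp_smul f hp0 hr (1 / 2) 8
  have e4 := eLpNorm'_comp_smul f (by linarith : 0 < q) hr (1 / 2) 8
  rw [e1, e2, e3, e4, mul_one] at h1
  refine h1.trans_eq ?_
  rw [rpow_scaling_combine (by simpa using hr) ENNReal.ofReal_ne_top ha₀.le ha₁ hbal]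

/-! ### Mollification and weak gradients -/

open scoped Convolution

/-- Jensen for the probability measure with density ρ, then Tonelli and translation invariance. -/
theorem lintegral_rpow_translate_le {d : ℕ} {ρ : Space d → ℝ≥0∞} (hρ : Measurable ρ)
    (h1 : ∫⁻ x, ρ x = 1) {H : Space d → ℝ≥0∞} (hH : AEMeasurable H volume) {p : ℝ} (hp : 1 ≤ p) :
    ∫⁻ x, (∫⁻ y, ρ y * H (x - y)) ^ p ≤ ∫⁻ x, H x ^ p := by
  -- A measurable representative is substituted in each inner integral, since Tonelli needs joint
  -- measurability of H(x - y).
  have hmod : ∀ x, ∫⁻ y, ρ y * H (x - y) = ∫⁻ y, ρ y * hH.mk H (x - y) := by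
    intro x
    refine lintegral_congr_ae ?_
    filter_upwards [(quasiMeasurePreserving_sub_left_of_right_invariant volume x).ae_eq_comp
      hH.ae_eq_mk] with y hy
    rw [Function.comp_apply, Function.comp_apply] at hy
    rw [hy]
  have hm := hH.measurable_mk
  set ν : Measure (Space d) := volume.withDensity ρ with hν
  have : IsProbabilityMeasure ν := ⟨by simp [hν, h1]⟩
  have hν' : ∀ F : Space d → ℝ≥0∞, Measurable F → ∫⁻ y, F y ∂ν = ∫⁻ y, ρ y * F y := by
    intro F hF
    rw [hν, lintegral_withDensity_eq_lintegral_mul _ hρ hF]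
    rfl
  have hsub : ∀ x : Space d, Measurable fun y => hH.mk H (x - y) := fun x => by fun_prop
  calc ∫⁻ x, (∫⁻ y, ρ y * H (x - y)) ^ p = ∫⁻ x, (∫⁻ y, hH.mk H (x - y) ∂ν) ^ p := by
        simp_rw [hmod, hν' _ (hsub _)]
    _ ≤ ∫⁻ x, ∫⁻ y, hH.mk H (x - y) ^ p ∂ν := by
        gcongr with x
        exact lintegral_rpow_le_of_isProbabilityMeasure (hsub x).aemeasurable hp
    _ = ∫⁻ y, (∫⁻ x, hH.mk H (x - y) ^ p) ∂ν := by
        refine lintegral_lintegral_swap ?_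
        exact (by fun_prop : Measurable fun z : Space d × Space d =>
          hH.mk H (z.1 - z.2) ^ p).aemeasurable
    _ = ∫⁻ x, hH.mk H x ^ p := by
        have : ∀ y, ∫⁻ x, hH.mk H (x - y) ^ p = ∫⁻ x, hH.mk H x ^ p := fun y =>
          lintegral_sub_right_eq_self (fun x => hH.mk H x ^ p) y
        simp_rw [this]
        rw [lintegral_const, measure_univ, mul_one]
    _ = ∫⁻ x, H x ^ p := by
        refine lintegral_congr_ae ?_
        filter_upwards [hH.ae_eq_mk] with x hx
        rw [hx]

theorem eLpNorm'_mollify_le {d : ℕ} {F F' : Type*} [NormedAddCommGroup F] [NormedAddCommGroup F']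
    {ρ : Space d → ℝ} (hρ : Measurable ρ)
    (h1 : ∫⁻ x, ‖ρ x‖ₑ = 1) {h : Space d → F} {A K : Set (Space d)} (hA : MeasurableSet A)
    (hK : MeasurableSet K) (hh : AEStronglyMeasurable h (volume.restrict K)) {p : ℝ} (hp : 1 ≤ p)
    {f : Space d → F'} (hf : ∀ x ∈ A, ‖f x‖ₑ ≤ ∫⁻ y, ‖ρ y‖ₑ * ‖K.indicator h (x - y)‖ₑ) :
    eLpNorm' f p (volume.restrict A) ≤ eLpNorm' h p (volume.restrict K) := by
  have hp0 : 0 < p := by linarith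
  unfold eLpNorm'
  gcongr ?_ ^ _
  calc ∫⁻ x in A, ‖f x‖ₑ ^ p ≤ ∫⁻ x in A, (∫⁻ y, ‖ρ y‖ₑ * ‖K.indicator h (x - y)‖ₑ) ^ p := by
        refine setLIntegral_mono' hA fun x hx => ?_
        gcongr
        exact hf x hx
    _ ≤ ∫⁻ x, (∫⁻ y, ‖ρ y‖ₑ * ‖K.indicator h (x - y)‖ₑ) ^ p := setLIntegral_le_lintegral _ _
    _ ≤ ∫⁻ x, ‖K.indicator h x‖ₑ ^ p :=
        lintegral_rpow_translate_le hρ.enorm h1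
          ((aestronglyMeasurable_indicator_iff hK).mpr hh).enorm hp
    _ = ∫⁻ x in K, ‖h x‖ₑ ^ p := by
        rw [← lintegral_indicator hK]
        congr 1
        ext x
        by_cases hx : x ∈ K <;> simp [hx, hp0]

/-- The reflected kernel t ↦ ρ(x - t) is an admissible test function because the ball around x
avoids the origin. On its support u agrees with its truncation to K, so testing the weak gradient
against it moves the derivative from ρ to u. -/
theorem fderiv_mollify_eq {d : ℕ} {u : Space d → ℝ} {g : Space d → Space d}
    (hu : LocallyIntegrableOn u ({0}ᶜ : Set (Space d)) volume) (hg : IsWeakGradient u g)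
    {ρ : Space d → ℝ} (hρ : ContDiff ℝ ∞ ρ) {δ : ℝ} (hs : tsupport ρ ⊆ Metric.closedBall 0 δ)
    {K : Set (Space d)} (hK : MeasurableSet K) (huK : IntegrableOn u K volume) {x : Space d}
    (hxK : Metric.closedBall x δ ⊆ K) (hx0 : (0 : Space d) ∉ Metric.closedBall x δ) :
    fderiv ℝ (ρ ⋆[ContinuousLinearMap.lsmul ℝ ℝ, volume] K.indicator u) x =
      innerSL ℝ (∫ t, ρ (x - t) • g t) := by
  have hc : HasCompactSupport ρ := hasCompactSupport_of_tsupport_subset hs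
  have hρ1 : ContDiff ℝ 1 ρ := hρ.of_le (by exact_mod_cast le_top)
  have huL : LocallyIntegrable (K.indicator u) volume :=
    (huK.integrable_indicator hK).locallyIntegrable
  have hzero : ∀ t, t ∉ Metric.closedBall x δ → x - t ∉ tsupport ρ := by
    intro t ht hmem
    apply ht
    have := hs hmem
    rw [mem_closedBall_zero_iff] at this
    rwa [Metric.mem_closedBall, dist_comm, dist_eq_norm]
  set ψ : Space d → ℝ := fun t => ρ (x - t) with hψ
  have hψc : ContDiff ℝ ∞ ψ := hρ.comp (contDiff_const.sub contDiff_id)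
  have hψs : tsupport ψ ⊆ Metric.closedBall x δ := by
    refine closure_minimal ?_ Metric.isClosed_closedBall
    intro t ht
    by_contra h
    exact ht (image_eq_zero_of_notMem_tsupport (f := ρ) (hzero t h))
  have hψcs : HasCompactSupport ψ :=
    (isCompact_closedBall x δ).of_isClosed_subset (isClosed_tsupport ψ) hψs
  have hψ0 : tsupport ψ ⊆ ({0}ᶜ : Set (Space d)) := by
    intro t ht h0
    rw [mem_singleton_iff] at h0
    exact hx0 (h0 ▸ hψs ht)
  have hψd : ∀ t, fderiv ℝ ψ t = - fderiv ℝ ρ (x - t) := by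
    intro t
    have := ((hρ1.differentiable one_ne_zero (x - t)).hasFDerivAt.comp t
      ((hasFDerivAt_id t).const_sub x)).fderiv
    refine this.trans ?_
    ext y
    simp
  rw [← convolution_flip]
  rw [(hc.hasFDerivAt_convolution_right (ContinuousLinearMap.lsmul ℝ ℝ).flip huL hρ1 x).fderiv]
  ext v
  rw [convolution_precompR_apply _ huL (hc.fderiv ℝ) (hρ1.continuous_fderiv one_ne_zero)]
  have hwg := hg.integral_eq ψ hψc hψcs hψ0
  have hint : Integrable (fun t => u t • gradient ψ t) volume := by
    have hgc : Continuous (gradient ψ) := by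
      have := hψc.continuous_fderiv (by simp)
      exact (InnerProductSpace.toDual ℝ (Space d)).symm.continuous.comp this
    have hgs : Function.support (gradient ψ) ⊆ tsupport ψ := by
      intro t ht
      refine support_fderiv_subset ℝ fun h0 => ht ?_
      rw [gradient, h0, map_zero]
    have h1 : IntegrableOn u (tsupport ψ) volume := hu.integrableOn_compact_subset hψ0 hψcs
    have h2 : IntegrableOn (fun t => u t • gradient ψ t) (tsupport ψ) volume :=
      h1.smul_continuousOn hgc.continuousOn hψcs
    refine (integrableOn_iff_integrable_of_support_subset ?_).mp h2
    exact (Function.support_smul_subset_right u (gradient ψ)).trans hgs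
  have h3 : (∫ t, u t * fderiv ℝ ψ t v) = inner ℝ (∫ t, u t • gradient ψ t) v := by
    rw [real_inner_comm, ← integral_inner hint]
    congr 1
    ext t
    rw [inner_smul_right, real_inner_comm, gradient, InnerProductSpace.toDual_symm_apply]
  rw [innerSL_apply_apply, ← neg_neg (∫ t, ρ (x - t) • g t), ← hwg, inner_neg_left, ← h3,
    ← integral_neg, convolution_def]
  congr 1
  ext t
  rw [hψd]
  by_cases ht : t ∈ Metric.closedBall x δ
  · simp [indicator_of_mem (hxK ht), mul_comm]
  · have : fderiv ℝ ρ (x - t) = 0 := by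
      by_contra h
      exact hzero t ht (support_fderiv_subset ℝ h)
    simp [this]

theorem enorm_fderiv_mollify_le {d : ℕ} {u : Space d → ℝ} {g : Space d → Space d}
    (hu : LocallyIntegrableOn u ({0}ᶜ : Set (Space d)) volume) (hg : IsWeakGradient u g)
    {ρ : Space d → ℝ} (hρ : ContDiff ℝ ∞ ρ) {δ : ℝ} (hs : tsupport ρ ⊆ Metric.closedBall 0 δ)
    {K : Set (Space d)} (hK : MeasurableSet K) (huK : IntegrableOn u K volume) {x : Space d}
    (hxK : Metric.closedBall x δ ⊆ K) (hx0 : (0 : Space d) ∉ Metric.closedBall x δ) :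
    ‖fderiv ℝ (ρ ⋆[ContinuousLinearMap.lsmul ℝ ℝ, volume] K.indicator u) x‖ₑ ≤
      ∫⁻ y, ‖ρ y‖ₑ * ‖K.indicator g (x - y)‖ₑ := by
  rw [fderiv_mollify_eq hu hg hρ hs hK huK hxK hx0]
  have : ‖innerSL ℝ (∫ t, ρ (x - t) • g t)‖ₑ = ‖∫ t, ρ (x - t) • g t‖ₑ := by
    rw [← ofReal_norm, innerSL_apply_norm, ofReal_norm]
  rw [this]
  refine (enorm_integral_le_lintegral_enorm _).trans_eq ?_
  rw [← lintegral_sub_left_eq_self _ x]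
  congr 1
  ext y
  rw [sub_sub_cancel, enorm_smul]
  by_cases hy : x - y ∈ K
  · rw [indicator_of_mem hy]
  · have : ρ y = 0 := by
      by_contra h
      refine hy (hxK ?_)
      have := hs (subset_tsupport ρ h)
      rw [mem_closedBall_zero_iff] at this
      rw [Metric.mem_closedBall, dist_eq_norm]
      simpa using this
    simp [this]

theorem enorm_mollify_le {d : ℕ} {ρ v : Space d → ℝ} (x : Space d) :
    ‖(ρ ⋆[ContinuousLinearMap.lsmul ℝ ℝ, volume] v) x‖ₑ ≤ ∫⁻ y, ‖ρ y‖ₑ * ‖v (x - y)‖ₑ := by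
  rw [convolution_def]
  refine (enorm_integral_le_lintegral_enorm _).trans_eq ?_
  congr 1
  ext y
  rw [ContinuousLinearMap.lsmul_apply, enorm_smul]

theorem annulus_subset_isCompact {d : ℕ} {r s : ℝ} (hr : 0 < r) :
    ∃ K : Set (Space d), IsCompact K ∧ annulus r s ⊆ K ∧ K ⊆ ({0}ᶜ : Set (Space d)) := by
  refine ⟨Metric.closedBall 0 s ∩ {x | r ≤ ‖x‖}, (isCompact_closedBall 0 s).inter_right
    (isClosed_le continuous_const continuous_norm), fun x hx => ⟨?_, hx.1⟩, fun x hx h0 => ?_⟩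
  · simpa using hx.2.le
  · rw [mem_singleton_iff] at h0
    have := hx.2
    simp only [h0, mem_ofPred_eq, norm_zero] at this
    linarith

theorem integrableOn_annulus {d : ℕ} {F : Type*} [NormedAddCommGroup F] {u : Space d → F}
    (hu : LocallyIntegrableOn u ({0}ᶜ : Set (Space d)) volume) {r : ℝ} (hr : 0 < r) (s : ℝ) :
    IntegrableOn u (annulus r s) volume := by
  obtain ⟨K, hK, h1, h2⟩ := annulus_subset_isCompact (d := d) (s := s) hr
  exact (hu.integrableOn_compact_subset h2 hK).mono_set h1

/-- On this shell r/|x| lies between 1/16 and 16, so (r/|x|)^α ≤ 16^|α| whatever the sign of α. -/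
theorem rpow_mul_eLpNorm'_annulus_le {d : ℕ} {F : Type*} [NormedAddCommGroup F]
    [NormedSpace ℝ F] (g : Space d → F) {r p : ℝ} (α : ℝ) (hp : 0 < p) (hr : 0 < r) :
    ENNReal.ofReal r ^ α * eLpNorm' g p (volume.restrict (annulus (r * (1 / 4)) (r * 16))) ≤
      ENNReal.ofReal (16 ^ |α|) *
        eLpNorm' (fun x => ‖x‖ ^ α • g x) p (volume.restrict (annulus (r * (1 / 4)) (r * 16))) := by
  have key : ∀ x ∈ (annulus (r * (1 / 4)) (r * 16) : Set (Space d)),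
      (ENNReal.ofReal r ^ α) ^ p * ‖g x‖ₑ ^ p ≤
        ENNReal.ofReal (16 ^ |α|) ^ p * ‖‖x‖ ^ α • g x‖ₑ ^ p := by
    intro x hx
    have hx0 : 0 < ‖x‖ := lt_of_lt_of_le (by positivity) hx.1
    have h1 : r ^ α ≤ 16 ^ |α| * ‖x‖ ^ α := by
      rw [← div_le_iff₀ (by positivity), ← Real.div_rpow hr.le hx0.le]
      have h2 : r / ‖x‖ ≤ 16 := by
        rw [div_le_iff₀ hx0]
        linarith [hx.1]
      have h3 : 16⁻¹ ≤ r / ‖x‖ := by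
        rw [le_div_iff₀ hx0]
        linarith [hx.2]
      rcases le_total 0 α with h | h
      · rw [abs_of_nonneg h]
        gcongr
      · rw [abs_of_nonpos h, Real.rpow_neg (by norm_num), ← Real.inv_rpow (by norm_num)]
        exact Real.rpow_le_rpow_of_nonpos (by norm_num) h3 h
    rw [← ENNReal.mul_rpow_of_nonneg _ _ hp.le, ← ENNReal.mul_rpow_of_nonneg _ _ hp.le,
      enorm_smul, ENNReal.ofReal_rpow_of_pos hr, ← mul_assoc, ← ofReal_norm (‖x‖ ^ α),
      Real.norm_of_nonneg (by positivity), ← ENNReal.ofReal_mul (by positivity)]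
    gcongr
  have h2 := setLIntegral_mono' (μ := volume) (measurableSet_annulus _ _) key
  have hR : ENNReal.ofReal r ^ α ≠ ⊤ :=
    ENNReal.rpow_ne_top_of_ne_zero (by simpa using hr) ENNReal.ofReal_ne_top
  rw [lintegral_const_mul' _ _ (ENNReal.rpow_ne_top_of_nonneg hp.le hR),
    lintegral_const_mul' _ _ (ENNReal.rpow_ne_top_of_nonneg hp.le ENNReal.ofReal_ne_top)] at h2
  have h3 : ∀ c I : ℝ≥0∞, c * I ^ (1 / p) = (c ^ p * I) ^ (1 / p) := by
    intro c I
    rw [ENNReal.mul_rpow_of_nonneg _ _ (by positivity), ← ENNReal.rpow_mul,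
      mul_one_div_cancel hp.ne', ENNReal.rpow_one]
  unfold eLpNorm'
  rw [h3, h3]
  gcongr

/-- The smooth estimate is applied to mollifications of u truncated to a slightly larger shell.
Mollifying does not increase the norms on the right, and Fatou handles the left side. The constant
does not depend on r. -/
theorem exists_shell_estimate {d : ℕ} (hd : 1 ≤ d) {p q τ a α β : ℝ} (hp : 1 ≤ p)
    (hq : 1 ≤ q) (hτ : 1 ≤ τ) (ha₀ : 0 < a) (ha₁ : a ≤ 1)
    (h : a * (1 / p - 1 / d) + (1 - a) * (1 / q) ≤ 1 / τ)
    (hbal : a * (α - 1 + d / p) + (1 - a) * (β + d / q) = 0) :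
    ∃ C : ℝ≥0∞, C ≠ ⊤ ∧ ∀ (u : Space d → ℝ) (g : Space d → Space d),
      LocallyIntegrableOn u ({0}ᶜ : Set (Space d)) volume → IsWeakGradient u g →
      ∀ r : ℝ, 0 < r → ENNReal.ofReal r ^ (-(d / τ)) *
          eLpNorm' (fun x => u x - u ((2 : ℝ) • x)) τ (volume.restrict (annulus r (r * 2))) ≤
        C * (eLpNorm' (fun x => ‖x‖ ^ α • g x) p
              (volume.restrict (annulus (r * (1 / 4)) (r * 16))) ^ a *
          eLpNorm' (fun x => ‖x‖ ^ β * u x) q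
              (volume.restrict (annulus (r * (1 / 4)) (r * 16))) ^ (1 - a)) := by
  obtain ⟨C, hC, hD⟩ := exists_eLpNorm'_sub_dilate_le_scaled hd hp hq hτ ha₀ ha₁ h hbal
  have ha : 0 ≤ 1 - a := by linarith
  have hp0 : 0 < p := by linarith
  have hq0 : 0 < q := by linarith
  refine ⟨C * (ENNReal.ofReal (16 ^ |α|) ^ a * ENNReal.ofReal (16 ^ |β|) ^ (1 - a)), ?_,
    fun u g hu hg r hr => ?_⟩
  · exact ENNReal.mul_ne_top hC (ENNReal.mul_ne_top
      (ENNReal.rpow_ne_top_of_nonneg ha₀.le ENNReal.ofReal_ne_top)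
      (ENNReal.rpow_ne_top_of_nonneg ha ENNReal.ofReal_ne_top))
  set K : Set (Space d) := annulus (r * (1 / 4)) (r * 16) with hKdef
  have hK : MeasurableSet K := measurableSet_annulus _ _
  have huK : IntegrableOn u K volume := integrableOn_annulus hu (by positivity) _
  have hgK : IntegrableOn g K volume :=
    integrableOn_annulus hg.locallyIntegrableOn (by positivity) _
  -- The outer radius is at most r/4, so balls around points with r/2 ≤ |x| < 8r stay in K. The
  -- fixed ratio 2 of the radii is what almost everywhere convergence of the convolutions asks for.
  let φ : ℕ → ContDiffBump (0 : Space d) := fun n =>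
    ⟨r / 8 * (1 / ((n : ℝ) + 1)), r / 4 * (1 / ((n : ℝ) + 1)), by positivity, by gcongr; norm_num⟩
  have hφK : ∀ n, (φ n).rOut ≤ r / 4 := by
    intro n
    have : 1 / ((n : ℝ) + 1) ≤ 1 := by
      rw [div_le_one (by positivity)]
      linarith [n.cast_nonneg (α := ℝ)]
    exact mul_le_of_le_one_right (by positivity) this
  have hφt : Tendsto (fun n => (φ n).rOut) atTop (𝓝 0) := by
    have := tendsto_one_div_add_atTop_nhds_zero_nat.const_mul (r / 4)
    rwa [mul_zero] at this
  let f : ℕ → Space d → ℝ := fun n =>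
    (φ n).normed volume ⋆[ContinuousLinearMap.lsmul ℝ ℝ, volume] K.indicator u
  have huL : LocallyIntegrable (K.indicator u) volume :=
    (huK.integrable_indicator hK).locallyIntegrable
  have hf : ∀ n, ContDiff ℝ 1 (f n) := fun n =>
    (φ n).hasCompactSupport_normed.contDiff_convolution_left _ (φ n).contDiff_normed huL
  have hρ1 : ∀ n, ∫⁻ x, ‖(φ n).normed volume x‖ₑ = 1 := by
    intro n
    have h1 := ofReal_integral_eq_lintegral_ofReal ((φ n).integrable_normed (μ := volume))
      (Eventually.of_forall (φ n).nonneg_normed)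
    rw [(φ n).integral_normed, ENNReal.ofReal_one] at h1
    rw [h1]
    congr 1
    ext x
    rw [← ofReal_norm, Real.norm_of_nonneg ((φ n).nonneg_normed x)]
  have hlim : ∀ᵐ x : Space d, Tendsto (fun n => f n x) atTop (𝓝 (K.indicator u x)) :=
    ContDiffBump.ae_convolution_tendsto_right_of_locallyIntegrable (K := 2) hφt
      (Eventually.of_forall fun n => by
        change r / 4 * _ ≤ 2 * (r / 8 * _)
        linarith) huL
  have hlim2 : ∀ᵐ x : Space d,
      Tendsto (fun n => f n ((2 : ℝ) • x)) atTop (𝓝 (K.indicator u ((2 : ℝ) • x))) :=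
    (Measure.quasiMeasurePreserving_smul volume (two_ne_zero (α := ℝ))).ae hlim
  have hKu : ∀ᵐ x ∂(volume.restrict (annulus r (r * 2) : Set (Space d))),
      Tendsto (fun n => f n x - f n ((2 : ℝ) • x)) atTop (𝓝 (u x - u ((2 : ℝ) • x))) := by
    filter_upwards [ae_restrict_of_ae hlim, ae_restrict_of_ae hlim2,
      ae_restrict_mem (measurableSet_annulus _ _)] with x h1 h2 hx
    have hx1 : x ∈ K := annulus_subset (by linarith) (by linarith) hx
    have hx2 : (2 : ℝ) • x ∈ K :=
      annulus_subset (by linarith) (by linarith) ((smul_mem_annulus_iff two_pos).mpr hx)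
    rw [indicator_of_mem hx1] at h1
    rw [indicator_of_mem hx2] at h2
    exact h1.sub h2
  have hfat := Lp.eLpNorm'_lim_le_liminf_eLpNorm' (by linarith : 0 < τ)
    (fun n => ((hf n).sub ((hf n).comp (contDiff_const_smul 2))).continuous.aestronglyMeasurable)
    hKu
  have hnear : ∀ n, ∀ x ∈ (annulus (r * (1 / 2)) (r * 8) : Set (Space d)),
      Metric.closedBall x (φ n).rOut ⊆ K := by
    intro n x hx y hy
    rw [Metric.mem_closedBall, dist_eq_norm] at hy
    have h1 := hφK n
    have h2 := norm_sub_norm_le x y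
    have h3 := norm_sub_norm_le y x
    rw [norm_sub_rev] at h2
    have := hx.1
    have := hx.2
    constructor <;> linarith
  have hG : ∀ n, eLpNorm' (fderiv ℝ (f n)) p (volume.restrict (annulus (r * (1 / 2)) (r * 8))) ≤
      eLpNorm' g p (volume.restrict K) := by
    intro n
    refine eLpNorm'_mollify_le (φ n).continuous_normed.measurable (hρ1 n)
      (measurableSet_annulus _ _) hK hgK.aestronglyMeasurable hp fun x hx => ?_
    refine enorm_fderiv_mollify_le (δ := (φ n).rOut) hu hg (φ n).contDiff_normed ?_ hK huK
      (hnear n x hx) ?_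
    · rw [(φ n).tsupport_normed_eq]
    · intro h0
      have := (hnear n x hx h0).1
      rw [norm_zero] at this
      linarith
  have hN : ∀ n, eLpNorm' (f n) q (volume.restrict (annulus (r * (1 / 2)) (r * 8))) ≤
      eLpNorm' u q (volume.restrict K) := by
    intro n
    exact eLpNorm'_mollify_le (φ n).continuous_normed.measurable (hρ1 n)
      (measurableSet_annulus _ _) hK huK.aestronglyMeasurable hq fun x _ => enorm_mollify_le x
  set R := ENNReal.ofReal r with hRdef
  have hR0 : R ^ (-(d / τ)) ≠ ⊤ :=
    ENNReal.rpow_ne_top_of_ne_zero (by simpa [hRdef] using hr) ENNReal.ofReal_ne_top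
  set B := C * ((R ^ α * eLpNorm' g p (volume.restrict K)) ^ a *
    (R ^ β * eLpNorm' u q (volume.restrict K)) ^ (1 - a)) with hB
  -- The scaling factor goes to the right side so that the liminf from Fatou is compared with a
  -- constant.
  have hbound : ∀ n, eLpNorm' (fun x => f n x - f n ((2 : ℝ) • x)) τ
      (volume.restrict (annulus r (r * 2))) ≤ (R ^ (-(d / τ)))⁻¹ * B := by
    intro n
    rw [← ENNReal.mul_le_iff_le_inv (ENNReal.rpow_pos (by simpa [hRdef] using hr)
      ENNReal.ofReal_ne_top).ne' hR0]
    refine (hD (f n) (hf n) r hr).trans ?_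
    rw [hB]
    gcongr
    · exact hG n
    · exact hN n
  calc _ ≤ R ^ (-(d / τ)) * ((R ^ (-(d / τ)))⁻¹ * B) := by
        gcongr
        refine hfat.trans ?_
        refine (liminf_le_liminf (Eventually.of_forall hbound)).trans ?_
        rw [liminf_const]
    _ ≤ B := by
        rw [← mul_assoc]
        exact mul_le_of_le_one_left zero_le (ENNReal.mul_inv_le_one _)
    _ ≤ C * ((ENNReal.ofReal (16 ^ |α|) *
          eLpNorm' (fun x => ‖x‖ ^ α • g x) p (volume.restrict K)) ^ a *
        (ENNReal.ofReal (16 ^ |β|) *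
          eLpNorm' (fun x => ‖x‖ ^ β * u x) q (volume.restrict K)) ^ (1 - a)) := by
        rw [hB]
        gcongr C * (?_ ^ a * ?_ ^ (1 - a))
        · exact rpow_mul_eLpNorm'_annulus_le g α hp0 hr
        · exact rpow_mul_eLpNorm'_annulus_le u β hq0 hr
    _ = _ := by
        rw [ENNReal.mul_rpow_of_nonneg _ _ ha₀.le, ENNReal.mul_rpow_of_nonneg _ _ ha]
        ring

/-! ### Inequalities for sequences -/

section Sums

theorem tsum_rpow_le_rpow_tsum {ι : Type*} (z : ι → ℝ≥0∞) {s : ℝ} (hs : 1 ≤ s) :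
    ∑' k, z k ^ s ≤ (∑' k, z k) ^ s := by
  have h : ∀ x : ℝ≥0∞, x ^ s = x * x ^ (s - 1) := by
    intro x
    nth_rw 2 [← ENNReal.rpow_one x]
    rw [← ENNReal.rpow_add_of_nonneg _ _ zero_le_one (by linarith)]
    congr 1
    ring
  simp_rw [h]
  rw [← ENNReal.tsum_mul_right]
  gcongr with k
  exact ENNReal.le_tsum k

/-- Hölder handles exponents with sum exactly 1; the excess in s + t is absorbed by the inclusion of
ℓ^1 in ℓ^(s+t). -/
theorem tsum_rpow_mul_rpow_le (x y : ℕ → ℝ≥0∞) {s t : ℝ} (hs : 0 ≤ s) (ht : 0 ≤ t)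
    (hst : 1 ≤ s + t) :
    ∑' k, x k ^ s * y k ^ t ≤ (∑' k, x k) ^ s * (∑' k, y k) ^ t := by
  have h0 : 0 < s + t := by linarith
  have h1 := ENNReal.lintegral_mul_norm_pow_le (μ := Measure.count) (f := x) (g := y)
    (by fun_prop) (by fun_prop) (p := s / (s + t)) (q := t / (s + t)) (by positivity)
    (by positivity) (by field_simp)
  simp only [lintegral_count] at h1
  calc ∑' k, x k ^ s * y k ^ t
      = ∑' k, (x k ^ (s / (s + t)) * y k ^ (t / (s + t))) ^ (s + t) := by
        congr 1
        ext k
        rw [ENNReal.mul_rpow_of_nonneg _ _ h0.le, ← ENNReal.rpow_mul, ← ENNReal.rpow_mul,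
          div_mul_cancel₀ _ h0.ne', div_mul_cancel₀ _ h0.ne']
    _ ≤ (∑' k, x k ^ (s / (s + t)) * y k ^ (t / (s + t))) ^ (s + t) :=
        tsum_rpow_le_rpow_tsum _ hst
    _ ≤ ((∑' k, x k) ^ (s / (s + t)) * (∑' k, y k) ^ (t / (s + t))) ^ (s + t) := by gcongr
    _ = _ := by
        rw [ENNReal.mul_rpow_of_nonneg _ _ h0.le, ← ENNReal.rpow_mul, ← ENNReal.rpow_mul,
          div_mul_cancel₀ _ h0.ne', div_mul_cancel₀ _ h0.ne']

theorem sum_rpow_neg_half_le (k : ℕ) :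
    ∑ j ∈ Finset.range k, ((j : ℝ) + 1) ^ (-(1 / 2) : ℝ) ≤ 2 * (k : ℝ) ^ (1 / 2 : ℝ) := by
  induction k with
  | zero => simp
  | succ k ih =>
    rw [Finset.sum_range_succ]
    push_cast
    rw [Real.rpow_neg (by positivity), ← Real.sqrt_eq_rpow]
    rw [← Real.sqrt_eq_rpow] at ih
    have h1 := Real.sq_sqrt (by positivity : (0 : ℝ) ≤ k)
    have h2 := Real.sq_sqrt (by positivity : (0 : ℝ) ≤ (k : ℝ) + 1)
    have h3 : 0 < √((k : ℝ) + 1) := Real.sqrt_pos.mpr (by positivity)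
    have h4 : (√((k : ℝ) + 1))⁻¹ ≤ 2 * √((k : ℝ) + 1) - 2 * √k := by
      rw [inv_le_iff_one_le_mul₀ h3]
      nlinarith [sq_nonneg (√((k : ℝ) + 1) - √k)]
    linarith

/-- From log(1 + 1/x) ≥ 1/(x+1) and exp y ≥ 1 + y, the difference on the right is at least
(s-1)(x+1)^(-s); the factor 2^s comes from x + 1 ≤ 2x. -/
theorem rpow_neg_le_telescope {s : ℝ} (hs : 1 < s) {x : ℝ} (hx : 1 ≤ x) :
    x ^ (-s) ≤ 2 ^ s / (s - 1) * (x ^ (1 - s) - (x + 1) ^ (1 - s)) := by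
  have hx0 : 0 < x := by linarith
  have hs1 : 0 < s - 1 := by linarith
  have h1 : (1 + 1 / x) ^ (s - 1) ≥ 1 + (s - 1) / (x + 1) := by
    have h2 := Real.one_sub_inv_le_log_of_pos (by positivity : 0 < 1 + 1 / x)
    have h3 : 1 - (1 + 1 / x)⁻¹ = 1 / (x + 1) := by field_simp; ring
    rw [Real.rpow_def_of_pos (by positivity)]
    have h4 := Real.add_one_le_exp (Real.log (1 + 1 / x) * (s - 1))
    rw [h3] at h2
    have h5 := mul_le_mul_of_nonneg_right h2 hs1.le
    have h6 : 1 / (x + 1) * (s - 1) = (s - 1) / (x + 1) := by ring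
    linarith
  have h2 : x ^ (1 - s) = (x + 1) ^ (1 - s) * (1 + 1 / x) ^ (s - 1) := by
    rw [show 1 + 1 / x = (x + 1) / x by field_simp, Real.div_rpow (by positivity) hx0.le,
      show 1 - s = -(s - 1) by ring, Real.rpow_neg (by positivity), Real.rpow_neg (by positivity)]
    field_simp
  have h3 : (x + 1) ^ (1 - s) = (x + 1) ^ (-s) * (x + 1) := by
    rw [show 1 - s = -s + 1 by ring, Real.rpow_add (by positivity), Real.rpow_one]
  have h4 : (s - 1) * (x + 1) ^ (-s) ≤ x ^ (1 - s) - (x + 1) ^ (1 - s) := by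
    rw [h2]
    have h5 : 0 ≤ (x + 1) ^ (1 - s) := by positivity
    calc (s - 1) * (x + 1) ^ (-s) = (x + 1) ^ (1 - s) * ((s - 1) / (x + 1)) := by
          rw [h3]; field_simp
      _ ≤ (x + 1) ^ (1 - s) * ((1 + 1 / x) ^ (s - 1) - 1) := by
          gcongr
          linarith
      _ = _ := by ring
  have h5 : x ^ (-s) ≤ 2 ^ s * (x + 1) ^ (-s) := by
    rw [Real.rpow_neg (by positivity), Real.rpow_neg (by positivity), ← div_eq_mul_inv,
      inv_le_comm₀ (by positivity) (by positivity), inv_div, ← Real.div_rpow (by positivity)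
      (by norm_num)]
    gcongr
    linarith
  calc x ^ (-s) ≤ 2 ^ s * (x + 1) ^ (-s) := h5
    _ = 2 ^ s / (s - 1) * ((s - 1) * (x + 1) ^ (-s)) := by field_simp
    _ ≤ _ := by gcongr

theorem tsum_rpow_neg_tail_le {s : ℝ} (hs : 1 < s) (j : ℕ) :
    ∑' i : ℕ, ENNReal.ofReal ((((i + j : ℕ) : ℝ) + 1) ^ (-s)) ≤
      ENNReal.ofReal (2 ^ s / (s - 1)) * ENNReal.ofReal (((j : ℝ) + 1) ^ (1 - s)) := by
  have hs1 : 0 < s - 1 := by linarith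
  refine ENNReal.tsum_le_of_sum_range_le fun n => ?_
  rw [← ENNReal.ofReal_sum_of_nonneg (fun i _ => by positivity),
    ← ENNReal.ofReal_mul (by positivity)]
  apply ENNReal.ofReal_le_ofReal
  let t : ℕ → ℝ := fun i => (((i + j : ℕ) : ℝ) + 1) ^ (1 - s)
  calc ∑ i ∈ Finset.range n, (((i + j : ℕ) : ℝ) + 1) ^ (-s)
      ≤ ∑ i ∈ Finset.range n, 2 ^ s / (s - 1) * (t i - t (i + 1)) := by
        gcongr with i
        refine (rpow_neg_le_telescope hs (x := ((i + j : ℕ) : ℝ) + 1) (by simp; positivity)).trans_eq ?_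
        simp only [t]
        push_cast
        ring_nf
    _ = 2 ^ s / (s - 1) * (t 0 - t n) := by
        rw [← Finset.mul_sum, Finset.sum_range_sub']
    _ ≤ _ := by
        have : 0 ≤ t n := by positivity
        have h0 : t 0 = ((j : ℝ) + 1) ^ (1 - s) := by simp [t]
        rw [← h0]
        gcongr
        linarith

theorem tsum_sum_range_succ (F : ℕ → ℕ → ℝ≥0∞) :
    ∑' k, ∑ j ∈ Finset.range (k + 1), F k j = ∑' j, ∑' i, F (i + j) j := by
  have h1 : ∀ k, ∑ j ∈ Finset.range (k + 1), F k j = ∑' j, if j ≤ k then F k j else 0 := by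
    intro k
    rw [tsum_eq_sum (s := Finset.range (k + 1))]
    · refine Finset.sum_congr rfl fun j hj => ?_
      rw [if_pos (by simpa [Nat.lt_succ_iff] using hj)]
    · intro j hj
      rw [if_neg (by simpa [Nat.lt_succ_iff] using hj)]
  simp_rw [h1]
  rw [ENNReal.tsum_comm]
  congr 1
  ext j
  rw [← Summable.sum_add_tsum_nat_add' (k := j) ENNReal.summable, Finset.sum_eq_zero, zero_add]
  · simp
  · intro i hi
    rw [if_neg (by simpa using hi)]

/-- A discrete Hardy inequality. -/
theorem exists_discrete_hardy {τ μ : ℝ} (hτ : 1 ≤ τ) (hμ : 1 < μ) (hτμ : τ ≤ μ) :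
    ∃ C : ℝ≥0∞, C ≠ ⊤ ∧ ∀ V : ℕ → ℝ≥0∞,
      ∑' k : ℕ, ENNReal.ofReal (((k : ℝ) + 1) ^ (-μ)) * (∑ j ∈ Finset.range (k + 1), V j) ^ τ ≤
        C * ∑' k, V k ^ τ := by
  -- The decay exponent left in k after Hölder. If τ = 1 it equals μ > 1; otherwise τ ≤ μ gives s ≥
  -- (τ+1)/2 > 1. The final exponent of j+1 is 1 - s + (τ-1)/2 = τ - μ ≤ 0, so τ = μ is just
  -- allowed.
  set s := μ - (τ - 1) / 2 with hs
  have hs1 : 1 < s := by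
    rcases hτ.eq_or_lt with h | h
    · rw [hs, ← h]; linarith
    · linarith
  have hsτ : 1 - s + (τ - 1) / 2 ≤ 0 := by linarith
  have hτ0 : 0 < τ := by linarith
  have hτ1 : 0 ≤ τ - 1 := by linarith
  refine ⟨ENNReal.ofReal (2 ^ (τ - 1)) * ENNReal.ofReal (2 ^ s / (s - 1)), by finiteness,
    fun V => ?_⟩
  have h1 : ∀ k : ℕ, (∑ j ∈ Finset.range (k + 1), V j) ^ τ ≤
      ENNReal.ofReal (2 ^ (τ - 1)) * ENNReal.ofReal (((k : ℝ) + 1) ^ ((τ - 1) / 2)) *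
        ∑ j ∈ Finset.range (k + 1), ENNReal.ofReal (((j : ℝ) + 1) ^ ((τ - 1) / 2)) * V j ^ τ := by
    intro k
    -- Hölder with weights (j+1)^(-1/2): their partial sums grow only like the square root of k+1,
    -- and Tonelli over j ≤ k then needs only the tail of Σ (k+1)^(-s).
    have e1 := ENNReal.inner_le_weight_mul_Lp_of_nonneg (Finset.range (k + 1)) hτ
      (fun j => ENNReal.ofReal (((j : ℝ) + 1) ^ (-(1 / 2) : ℝ)))
      (fun j => ENNReal.ofReal (((j : ℝ) + 1) ^ (1 / 2 : ℝ)) * V j)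
    have e2 : ∀ j : ℕ, ENNReal.ofReal (((j : ℝ) + 1) ^ (-(1 / 2) : ℝ)) *
        (ENNReal.ofReal (((j : ℝ) + 1) ^ (1 / 2 : ℝ)) * V j) = V j := by
      intro j
      rw [← mul_assoc, ← ENNReal.ofReal_mul (by positivity), ← Real.rpow_add (by positivity)]
      norm_num
    have e3 : ∀ j : ℕ, ENNReal.ofReal (((j : ℝ) + 1) ^ (-(1 / 2) : ℝ)) *
        (ENNReal.ofReal (((j : ℝ) + 1) ^ (1 / 2 : ℝ)) * V j) ^ τ =
          ENNReal.ofReal (((j : ℝ) + 1) ^ ((τ - 1) / 2)) * V j ^ τ := by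
      intro j
      rw [ENNReal.mul_rpow_of_nonneg _ _ hτ0.le, ← mul_assoc,
        ENNReal.ofReal_rpow_of_pos (by positivity), ← Real.rpow_mul (by positivity),
        ← ENNReal.ofReal_mul (by positivity), ← Real.rpow_add (by positivity)]
      congr 3
      ring
    simp_rw [e2, e3] at e1
    have e4 : ∑ j ∈ Finset.range (k + 1), ENNReal.ofReal (((j : ℝ) + 1) ^ (-(1 / 2) : ℝ)) ≤
        ENNReal.ofReal (2 * ((k : ℝ) + 1) ^ (1 / 2 : ℝ)) := by
      rw [← ENNReal.ofReal_sum_of_nonneg (fun i _ => by positivity)]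
      apply ENNReal.ofReal_le_ofReal
      exact_mod_cast sum_rpow_neg_half_le (k + 1)
    set S := ∑ j ∈ Finset.range (k + 1), ENNReal.ofReal (((j : ℝ) + 1) ^ ((τ - 1) / 2)) * V j ^ τ
      with hS
    have hτi : 0 ≤ 1 - τ⁻¹ := by
      rw [sub_nonneg]
      exact inv_le_one_of_one_le₀ hτ
    calc (∑ j ∈ Finset.range (k + 1), V j) ^ τ
        ≤ (ENNReal.ofReal (2 * ((k : ℝ) + 1) ^ (1 / 2 : ℝ)) ^ (1 - τ⁻¹) * S ^ τ⁻¹) ^ τ := by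
          gcongr
          refine e1.trans ?_
          gcongr
      _ = _ := by
          rw [ENNReal.mul_rpow_of_nonneg _ _ hτ0.le, ← ENNReal.rpow_mul, ← ENNReal.rpow_mul,
            inv_mul_cancel₀ hτ0.ne', ENNReal.rpow_one, sub_mul, inv_mul_cancel₀ hτ0.ne', one_mul,
            ENNReal.ofReal_rpow_of_nonneg (by positivity) hτ1,
            Real.mul_rpow (by positivity) (by positivity), ← Real.rpow_mul (by positivity),
            ENNReal.ofReal_mul (by positivity), show (1 / 2 : ℝ) * (τ - 1) = (τ - 1) / 2 by ring]
  calc _ ≤ ∑' k : ℕ, ENNReal.ofReal (2 ^ (τ - 1)) * ∑ j ∈ Finset.range (k + 1),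
        ENNReal.ofReal (((k : ℝ) + 1) ^ (-s)) *
          (ENNReal.ofReal (((j : ℝ) + 1) ^ ((τ - 1) / 2)) * V j ^ τ) := by
        refine ENNReal.tsum_le_tsum fun k => ?_
        refine (mul_le_mul_right (h1 k) _).trans_eq ?_
        rw [← Finset.mul_sum, ← mul_assoc, ← mul_assoc, mul_comm (ENNReal.ofReal _)
          (ENNReal.ofReal (2 ^ (τ - 1))), mul_assoc (ENNReal.ofReal (2 ^ (τ - 1))),
          ← ENNReal.ofReal_mul (by positivity), ← Real.rpow_add (by positivity), mul_assoc]
        congr 5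
        rw [hs]; ring
    _ = ENNReal.ofReal (2 ^ (τ - 1)) * ∑' j : ℕ,
        (∑' i : ℕ, ENNReal.ofReal ((((i + j : ℕ) : ℝ) + 1) ^ (-s))) *
          (ENNReal.ofReal (((j : ℝ) + 1) ^ ((τ - 1) / 2)) * V j ^ τ) := by
        rw [ENNReal.tsum_mul_left, tsum_sum_range_succ fun k j =>
          ENNReal.ofReal (((k : ℝ) + 1) ^ (-s)) *
            (ENNReal.ofReal (((j : ℝ) + 1) ^ ((τ - 1) / 2)) * V j ^ τ)]
        simp_rw [ENNReal.tsum_mul_right]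
    _ ≤ ENNReal.ofReal (2 ^ (τ - 1)) * ∑' j : ℕ, ENNReal.ofReal (2 ^ s / (s - 1)) * V j ^ τ := by
        gcongr ENNReal.ofReal (2 ^ (τ - 1)) * ?_
        refine ENNReal.tsum_le_tsum fun j => ?_
        calc _ ≤ ENNReal.ofReal (2 ^ s / (s - 1)) * ENNReal.ofReal (((j : ℝ) + 1) ^ (1 - s)) *
              (ENNReal.ofReal (((j : ℝ) + 1) ^ ((τ - 1) / 2)) * V j ^ τ) := by
              gcongr
              exact tsum_rpow_neg_tail_le hs1 j
          _ = ENNReal.ofReal (2 ^ s / (s - 1)) *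
              ENNReal.ofReal (((j : ℝ) + 1) ^ (1 - s + (τ - 1) / 2)) * V j ^ τ := by
              rw [Real.rpow_add (by positivity), ENNReal.ofReal_mul (by positivity)]
              ring
          _ ≤ ENNReal.ofReal (2 ^ s / (s - 1)) * 1 * V j ^ τ := by
              gcongr
              rw [ENNReal.ofReal_le_one]
              exact Real.rpow_le_one_of_one_le_of_nonpos (by simp) hsτ
          _ = _ := by rw [mul_one]
    _ = _ := by
        rw [ENNReal.tsum_mul_left, mul_assoc]

end Sums

/-! ### Dyadic shells and telescoping -/

theorem restrict_compl_zero {d : ℕ} (hd : 1 ≤ d) :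
    (volume : Measure (Space d)).restrict ({0}ᶜ : Set (Space d)) = volume := by
  have : Nonempty (Fin d) := ⟨⟨0, hd⟩⟩
  exact restrict_compl_singleton 0

theorem aestronglyMeasurable_of_locallyIntegrableOn {d : ℕ} (hd : 1 ≤ d) {u : Space d → ℝ}
    (hu : LocallyIntegrableOn u ({0}ᶜ : Set (Space d)) volume) :
    AEStronglyMeasurable u volume := by
  have := hu.aestronglyMeasurable
  rwa [restrict_compl_zero hd] at this

/-- The scale invariant `L^τ` norm of `u` on the dyadic shell `{c 2^n ≤ |x| < c 2^(n+1)}`. -/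
noncomputable def shellNorm {d : ℕ} (τ c : ℝ) (u : Space d → ℝ) (n : ℤ) : ℝ≥0∞ :=
  ENNReal.ofReal (c * 2 ^ n) ^ (-(d / τ)) *
    eLpNorm' u τ (volume.restrict (annulus (c * 2 ^ n) (c * 2 ^ n * 2)))

/-- The Jacobian factor 2^(-d/τ) is exactly the change in the normalising power of the radius; this
is the scale invariance behind the telescoping. -/
theorem shellNorm_comp_smul {d : ℕ} {τ c : ℝ} (hτ : 0 < τ) (hc : 0 < c) (u : Space d → ℝ) (n : ℤ) :
    shellNorm τ c (fun x => u ((2 : ℝ) • x)) n = shellNorm τ c u (n + 1) := by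
  have h : c * 2 ^ (n + 1) = 2 * (c * 2 ^ n) := by
    rw [zpow_add_one₀ two_ne_zero]
    ring
  unfold shellNorm
  rw [eLpNorm'_comp_smul u hτ two_pos, ← mul_assoc, h, mul_assoc 2 (c * 2 ^ n) 2]
  congr 1
  have h0 : 0 < c * 2 ^ n := by positivity
  rw [mul_comm 2 (c * 2 ^ n), ENNReal.ofReal_mul h0.le,
    ENNReal.mul_rpow_of_ne_zero (by simpa using h0) (by simp)]

theorem shellNorm_add_le {d : ℕ} {τ c : ℝ} (hτ : 1 ≤ τ) {u v : Space d → ℝ}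
    (hu : AEStronglyMeasurable u volume) (hv : AEStronglyMeasurable v volume) (n : ℤ) :
    shellNorm τ c (fun x => u x + v x) n ≤ shellNorm τ c u n + shellNorm τ c v n := by
  unfold shellNorm
  rw [← mul_add]
  gcongr
  exact eLpNorm'_add_le hu.restrict hv.restrict hτ

theorem shellNorm_neg {d : ℕ} {τ c : ℝ} (u : Space d → ℝ) (n : ℤ) :
    shellNorm τ c (fun x => - u x) n = shellNorm τ c u n := by
  simp [shellNorm, eLpNorm']

theorem aestronglyMeasurable_dilate {d : ℕ} {u : Space d → ℝ}
    (hu : AEStronglyMeasurable u volume) :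
    AEStronglyMeasurable (fun x => u ((2 : ℝ) • x)) volume :=
  hu.comp_quasiMeasurePreserving
    (Measure.quasiMeasurePreserving_smul volume (two_ne_zero (α := ℝ)))

theorem shellNorm_le_succ_add {d : ℕ} {τ c : ℝ} (hτ : 1 ≤ τ) (hc : 0 < c) {u : Space d → ℝ}
    (hu : AEStronglyMeasurable u volume) (n : ℤ) :
    shellNorm τ c u n ≤
      shellNorm τ c u (n + 1) + shellNorm τ c (fun x => u x - u ((2 : ℝ) • x)) n := by
  have hu2 := aestronglyMeasurable_dilate hu
  have hs : AEStronglyMeasurable (fun x => u x - u ((2 : ℝ) • x)) volume := hu.sub hu2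
  have h := shellNorm_add_le (c := c) hτ hu2 hs n
  simpa [shellNorm_comp_smul (by linarith : 0 < τ) hc u n] using h

theorem shellNorm_succ_le_add {d : ℕ} {τ c : ℝ} (hτ : 1 ≤ τ) (hc : 0 < c) {u : Space d → ℝ}
    (hu : AEStronglyMeasurable u volume) (n : ℤ) :
    shellNorm τ c u (n + 1) ≤
      shellNorm τ c u n + shellNorm τ c (fun x => u x - u ((2 : ℝ) • x)) n := by
  have hu2 := aestronglyMeasurable_dilate hu
  have hs : AEStronglyMeasurable (fun x => -(u x - u ((2 : ℝ) • x))) volume := (hu.sub hu2).neg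
  have h := shellNorm_add_le (c := c) hτ hu hs n
  rw [← shellNorm_comp_smul (by linarith : 0 < τ) hc u n, ← shellNorm_neg (fun x => u x - _) n]
  simpa using h

theorem tsum_setLIntegral_dyadic_le {d : ℕ} {c : ℝ} (hc : 0 < c) (F : Space d → ℝ≥0∞) :
    ∑' n : ℤ, ∫⁻ x in annulus (c * 2 ^ n) (c * 2 ^ n * 2), F x ≤ ∫⁻ x, F x := by
  rw [← lintegral_iUnion (fun n => measurableSet_annulus _ _)]
  · exact setLIntegral_le_lintegral _ _
  have key : ∀ m n : ℤ, m < n → Disjoint (annulus (c * 2 ^ m) (c * 2 ^ m * 2) : Set (Space d))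
      (annulus (c * 2 ^ n) (c * 2 ^ n * 2)) := by
    intro m n hmn
    rw [Set.disjoint_left]
    intro x hx hy
    have h1 : (2 : ℝ) ^ (m + 1) ≤ 2 ^ n := zpow_le_zpow_right₀ one_le_two hmn
    rw [zpow_add_one₀ two_ne_zero] at h1
    have h2 := hx.2
    have h3 := hy.1
    nlinarith
  intro m n hmn
  rcases lt_or_gt_of_ne hmn with h | h
  · exact key m n h
  · exact (key n m h).symm

theorem setLIntegral_annulus_pow_le {d : ℕ} {r : ℝ} (F : Space d → ℝ≥0∞) (k : ℕ) :
    ∫⁻ x in annulus r (r * 2 ^ k), F x ≤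
      ∑ i ∈ Finset.range k, ∫⁻ x in annulus (r * 2 ^ i) (r * 2 ^ i * 2), F x := by
  induction k with
  | zero =>
    have : (annulus r (r * 2 ^ 0) : Set (Space d)) = ∅ := by
      ext x
      simp [mem_annulus]
    rw [this]
    simp
  | succ k ih =>
    rw [Finset.sum_range_succ]
    refine le_trans ?_ (add_le_add ih le_rfl)
    refine (lintegral_mono_set ?_).trans (lintegral_union_le _ _ _)
    intro x hx
    rcases lt_or_ge ‖x‖ (r * 2 ^ k) with h | h
    · exact Or.inl ⟨hx.1, h⟩
    · exact Or.inr ⟨h, by rw [mul_assoc, ← pow_succ]; exact hx.2⟩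

/-- Each enlarged shell has ratio of radii 64 = 2^6, so it is covered by six consecutive dyadic
shells, starting two below n. -/
theorem tsum_setLIntegral_overlap_le {d : ℕ} {c : ℝ} (hc : 0 < c) (F : Space d → ℝ≥0∞) :
    ∑' n : ℤ, ∫⁻ x in annulus (c * 2 ^ n * (1 / 4)) (c * 2 ^ n * 16), F x ≤
      6 * ∫⁻ x, F x := by
  have h1 : ∀ n : ℤ, ∫⁻ x in annulus (c * 2 ^ n * (1 / 4)) (c * 2 ^ n * 16), F x ≤
      ∑ i ∈ Finset.range 6, ∫⁻ x in annulus (c * 2 ^ (n + ((i : ℤ) - 2)))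
        (c * 2 ^ (n + ((i : ℤ) - 2)) * 2), F x := by
    intro n
    have := setLIntegral_annulus_pow_le (r := c * 2 ^ n * (1 / 4)) F 6
    convert! this using 3 with i
    · norm_num [mul_assoc]
    · rw [zpow_add₀ two_ne_zero, zpow_sub₀ two_ne_zero, zpow_natCast]
      have : (2 : ℝ) ^ (2 : ℤ) = 4 := by norm_num
      rw [this]
      congr 2 <;> ring
  calc _ ≤ ∑' n : ℤ, ∑ i ∈ Finset.range 6, ∫⁻ x in annulus (c * 2 ^ (n + ((i : ℤ) - 2)))
        (c * 2 ^ (n + ((i : ℤ) - 2)) * 2), F x := ENNReal.tsum_le_tsum h1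
    _ = ∑ i ∈ Finset.range 6, ∑' n : ℤ, ∫⁻ x in annulus (c * 2 ^ (n + ((i : ℤ) - 2)))
        (c * 2 ^ (n + ((i : ℤ) - 2)) * 2), F x :=
        Summable.tsum_finsetSum fun _ _ => ENNReal.summable
    _ ≤ ∑ i ∈ Finset.range 6, ∫⁻ x, F x := by
        gcongr with i
        refine le_trans (le_of_eq ?_) (tsum_setLIntegral_dyadic_le hc F)
        exact (Equiv.addRight ((i : ℤ) - 2)).tsum_eq
          fun n : ℤ => ∫⁻ x in annulus (c * 2 ^ n) (c * 2 ^ n * 2), F x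
    _ = _ := by simp

theorem eLpNorm'_rpow {X F : Type*} [MeasurableSpace X] {ν : Measure X} [NormedAddCommGroup F]
    (f : X → F) {p : ℝ} (hp : 0 < p) : eLpNorm' f p ν ^ p = ∫⁻ x, ‖f x‖ₑ ^ p ∂ν := by
  unfold eLpNorm'
  rw [← ENNReal.rpow_mul, one_div_mul_cancel hp.ne', ENNReal.rpow_one]

theorem tsum_eLpNorm'_overlap_le {d : ℕ} {F : Type*} [NormedAddCommGroup F] {c p : ℝ}
    (hc : 0 < c) (hp : 0 < p) (f : Space d → F) {ι : ℕ → ℤ} (hι : Function.Injective ι) :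
    ∑' j : ℕ, eLpNorm' f p (volume.restrict
      (annulus (c * 2 ^ ι j * (1 / 4)) (c * 2 ^ ι j * 16))) ^ p ≤ 6 * eLpNorm' f p volume ^ p := by
  simp_rw [eLpNorm'_rpow f hp]
  exact (ENNReal.tsum_comp_le_tsum_of_injective hι _).trans
    (tsum_setLIntegral_overlap_le hc fun x => ‖f x‖ₑ ^ p)

/-- Hardy, the shell estimate and Hölder for sequences are chained here. The indexings κ and ι are
left free so that the inward and outward cases share one argument; injectivity of ι ensures that no
enlarged shell is counted twice. -/
theorem exists_dyadic_estimate {d : ℕ} (hd : 1 ≤ d) {p q τ a α β μ : ℝ} (hp : 1 ≤ p)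
    (hq : 1 ≤ q) (hτ : 1 ≤ τ) (ha₀ : 0 < a) (ha₁ : a ≤ 1) (hμ : 1 < μ) (hτμ : τ ≤ μ)
    (h : a * (1 / p - 1 / d) + (1 - a) * (1 / q) ≤ 1 / τ)
    (h' : 1 / τ ≤ a * (1 / p) + (1 - a) * (1 / q))
    (hbal : a * (α - 1 + d / p) + (1 - a) * (β + d / q) = 0) :
    ∃ C : ℝ≥0∞, C ≠ ⊤ ∧ ∀ (u : Space d → ℝ) (g : Space d → Space d),
      LocallyIntegrableOn u ({0}ᶜ : Set (Space d)) volume → IsWeakGradient u g →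
      ∀ c : ℝ, 0 < c → ∀ κ ι : ℕ → ℤ, Function.Injective ι →
        (∀ k, shellNorm τ c u (κ k) ≤ ∑ j ∈ Finset.range (k + 1),
          shellNorm τ c (fun x => u x - u ((2 : ℝ) • x)) (ι j)) →
        ∑' k : ℕ, ENNReal.ofReal (((k : ℝ) + 1) ^ (-μ)) * shellNorm τ c u (κ k) ^ τ ≤
          C * (eLpNorm' (fun x => ‖x‖ ^ α • g x) p volume ^ a *
            eLpNorm' (fun x => ‖x‖ ^ β * u x) q volume ^ (1 - a)) ^ τ := by
  obtain ⟨C₁, hC₁, hS⟩ := exists_shell_estimate hd hp hq hτ ha₀ ha₁ h hbal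
  obtain ⟨C₂, hC₂, hH⟩ := exists_discrete_hardy hτ hμ hτμ
  have hp0 : 0 < p := by linarith
  have hq0 : 0 < q := by linarith
  have hτ0 : 0 < τ := by linarith
  have ha : 0 ≤ 1 - a := by linarith
  -- The τ-th power of the j-th shell bound is a product of p-th and q-th power integrals raised to
  -- s and t; `h'` is exactly s + t ≥ 1.
  set s := a * τ / p with hs
  set t := (1 - a) * τ / q with ht
  have hs0 : 0 ≤ s := by positivity
  have ht0 : 0 ≤ t := by positivity
  have hst : 1 ≤ s + t := by
    have := mul_le_mul_of_nonneg_left h' hτ0.le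
    rw [mul_one_div_cancel hτ0.ne'] at this
    refine this.trans_eq ?_
    rw [hs, ht]
    ring
  refine ⟨C₂ * (C₁ ^ τ * (6 ^ s * 6 ^ t)), by finiteness, fun u g hu hg c hc κ ι hι hU => ?_⟩
  set G := fun x => ‖x‖ ^ α • g x with hG
  set N := fun x => ‖x‖ ^ β * u x with hN
  let A : ℕ → Set (Space d) := fun j => annulus (c * 2 ^ ι j * (1 / 4)) (c * 2 ^ ι j * 16)
  calc ∑' k : ℕ, ENNReal.ofReal (((k : ℝ) + 1) ^ (-μ)) * shellNorm τ c u (κ k) ^ τ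
      ≤ ∑' k : ℕ, ENNReal.ofReal (((k : ℝ) + 1) ^ (-μ)) * (∑ j ∈ Finset.range (k + 1),
          shellNorm τ c (fun x => u x - u ((2 : ℝ) • x)) (ι j)) ^ τ := by
        refine ENNReal.tsum_le_tsum fun k => ?_
        gcongr
        exact hU k
    _ ≤ C₂ * ∑' j, shellNorm τ c (fun x => u x - u ((2 : ℝ) • x)) (ι j) ^ τ := hH _
    _ ≤ C₂ * ∑' j, (C₁ * (eLpNorm' G p (volume.restrict (A j)) ^ a *
          eLpNorm' N q (volume.restrict (A j)) ^ (1 - a))) ^ τ := by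
        gcongr C₂ * ?_
        refine ENNReal.tsum_le_tsum fun j => ?_
        gcongr
        exact hS u g hu hg (c * 2 ^ ι j) (by positivity)
    _ = C₂ * (C₁ ^ τ * ∑' j, (eLpNorm' G p (volume.restrict (A j)) ^ p) ^ s *
          (eLpNorm' N q (volume.restrict (A j)) ^ q) ^ t) := by
        rw [← ENNReal.tsum_mul_left (a := C₁ ^ τ)]
        congr 1
        refine tsum_congr fun j => ?_
        rw [ENNReal.mul_rpow_of_nonneg _ _ hτ0.le, ENNReal.mul_rpow_of_nonneg _ _ hτ0.le,
          ← ENNReal.rpow_mul, ← ENNReal.rpow_mul, ← ENNReal.rpow_mul, ← ENNReal.rpow_mul]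
        congr 3
        · rw [hs]; field_simp
        · rw [ht]; field_simp
    _ ≤ C₂ * (C₁ ^ τ * ((6 * eLpNorm' G p volume ^ p) ^ s * (6 * eLpNorm' N q volume ^ q) ^ t)) := by
        gcongr C₂ * (C₁ ^ τ * ?_)
        refine (tsum_rpow_mul_rpow_le _ _ hs0 ht0 hst).trans ?_
        gcongr
        · exact tsum_eLpNorm'_overlap_le hc hp0 G hι
        · exact tsum_eLpNorm'_overlap_le hc hq0 N hι
    _ = _ := by
        rw [ENNReal.mul_rpow_of_nonneg _ _ hs0, ENNReal.mul_rpow_of_nonneg _ _ ht0,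
          ENNReal.mul_rpow_of_nonneg _ _ hτ0.le,
          ← ENNReal.rpow_mul, ← ENNReal.rpow_mul, ← ENNReal.rpow_mul, ← ENNReal.rpow_mul,
          show p * s = a * τ by rw [hs]; field_simp, show q * t = (1 - a) * τ by rw [ht]; field_simp]
        ring

/-! ### The logarithmic weight and the two support conditions -/

/-- The exceptional set is null near each of its points, and a locally null set is null in a second
countable space. -/
theorem ae_eq_zero_of_notMem_essSupport {d : ℕ} (u : Space d → ℝ) :
    ∀ᵐ x : Space d, x ∉ essSupport u → u x = 0 := by
  rw [ae_iff]
  refine measure_null_of_locally_null _ fun x hx => ?_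
  simp only [mem_ofPred_eq, Classical.not_imp] at hx
  have h1 := hx.1
  simp only [essSupport, mem_ofPred_eq, not_not] at h1
  obtain ⟨U, hU, hu⟩ := h1
  obtain ⟨W, hWU, hW, hxW⟩ := mem_nhds_iff.mp hU
  refine ⟨W ∩ {y | ¬(y ∉ essSupport u → u y = 0)},
    inter_mem (mem_nhdsWithin_of_mem_nhds (hW.mem_nhds hxW)) self_mem_nhdsWithin, ?_⟩
  have h2 : ∀ᵐ y ∂(volume.restrict W), u y = 0 := ae_mono (Measure.restrict_mono hWU le_rfl) hu
  rw [ae_restrict_iff' hW.measurableSet, ae_iff] at h2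
  refine measure_mono_null (fun y hy => ?_) h2
  simp only [mem_ofPred_eq, Classical.not_imp]
  have h3 := hy.2
  simp only [mem_ofPred_eq, Classical.not_imp] at h3
  exact ⟨hy.1, h3.2⟩

theorem shellNorm_eq_zero {d : ℕ} {τ c : ℝ} (hτ : 0 < τ) {u : Space d → ℝ} {n : ℤ}
    (h : ∀ᵐ x : Space d, x ∈ (annulus (c * 2 ^ n) (c * 2 ^ n * 2) : Set (Space d)) → u x = 0) :
    shellNorm τ c u n = 0 := by
  have : u =ᵐ[volume.restrict (annulus (c * 2 ^ n) (c * 2 ^ n * 2))] 0 := by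
    rw [Filter.EventuallyEq, ae_restrict_iff' (measurableSet_annulus _ _)]
    exact h
  rw [shellNorm, eLpNorm'_congr_ae this, eLpNorm'_zero hτ, mul_zero]

/-- Summing over dyadic shells on which the logarithmic factor `l` is bounded below. -/
theorem lintegral_log_weight_le {d : ℕ} {τ γ μ c : ℝ} (hτ : 0 < τ) (hγ : γ * τ = -d) (hμ : 0 ≤ μ)
    (hc : 0 < c) (u : Space d → ℝ) (l : Space d → ℝ) (κ : ℕ → ℤ)
    (hcover : ∀ᵐ x : Space d, u x = 0 ∨
      ∃ k, x ∈ (annulus (c * 2 ^ κ k) (c * 2 ^ κ k * 2) : Set (Space d)))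
    (hl : ∀ k : ℕ, ∀ x ∈ (annulus (c * 2 ^ κ k) (c * 2 ^ κ k * 2) : Set (Space d)),
      ((k : ℝ) + 1) * Real.log 2 ≤ l x) :
    ∫⁻ x, ENNReal.ofReal (‖x‖ ^ (γ * τ) / l x ^ μ * |u x| ^ τ) ≤
      ENNReal.ofReal (Real.log 2 ^ (-μ)) *
        ∑' k : ℕ, ENNReal.ofReal (((k : ℝ) + 1) ^ (-μ)) * shellNorm τ c u (κ k) ^ τ := by
  set F : Space d → ℝ≥0∞ := fun x => ENNReal.ofReal (‖x‖ ^ (γ * τ) / l x ^ μ * |u x| ^ τ) with hF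
  set A : ℕ → Set (Space d) := fun k => annulus (c * 2 ^ κ k) (c * 2 ^ κ k * 2) with hA
  have hlog : 0 < Real.log 2 := Real.log_pos one_lt_two
  have h1 : ∫⁻ x, F x ≤ ∫⁻ x in ⋃ k, A k, F x := by
    rw [← lintegral_indicator (MeasurableSet.iUnion fun k => measurableSet_annulus _ _)]
    refine lintegral_mono_ae ?_
    filter_upwards [hcover] with x hx
    rcases hx with hx | hx
    · simp [hF, hx, hτ.ne']
    · rw [indicator_of_mem (mem_iUnion.mpr hx)]
  have h2 : ∀ k : ℕ, ∫⁻ x in A k, F x ≤ ENNReal.ofReal (Real.log 2 ^ (-μ)) *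
      (ENNReal.ofReal (((k : ℝ) + 1) ^ (-μ)) * shellNorm τ c u (κ k) ^ τ) := by
    intro k
    have hr : 0 < c * 2 ^ κ k := by positivity
    have h3 : ∀ x ∈ A k, F x ≤ ENNReal.ofReal (Real.log 2 ^ (-μ)) *
        (ENNReal.ofReal (((k : ℝ) + 1) ^ (-μ)) *
          ENNReal.ofReal ((c * 2 ^ κ k) ^ (-(d : ℝ)))) * ‖u x‖ₑ ^ τ := by
      intro x hx
      have hl' := hl k x hx
      have hl0 : 0 < l x := lt_of_lt_of_le (by positivity) hl'
      rw [hF, ← ofReal_norm, ENNReal.ofReal_rpow_of_nonneg (norm_nonneg _) hτ.le,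
        ← ENNReal.ofReal_mul (by positivity), ← ENNReal.ofReal_mul (by positivity),
        ← ENNReal.ofReal_mul (by positivity), Real.norm_eq_abs]
      apply ENNReal.ofReal_le_ofReal
      gcongr
      rw [div_eq_mul_inv, ← Real.rpow_neg hl0.le, hγ, mul_comm]
      calc l x ^ (-μ) * ‖x‖ ^ (-(d : ℝ))
          ≤ (((k : ℝ) + 1) * Real.log 2) ^ (-μ) * (c * 2 ^ κ k) ^ (-(d : ℝ)) := by
            gcongr ?_ * ?_
            · exact Real.rpow_le_rpow_of_nonpos (by positivity) hl' (by linarith)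
            · exact Real.rpow_le_rpow_of_nonpos hr hx.1 (by simp)
        _ = _ := by
            rw [Real.mul_rpow (by positivity) hlog.le]
            ring
    calc _ ≤ _ := setLIntegral_mono' (measurableSet_annulus _ _) h3
      _ = _ := by
        rw [lintegral_const_mul' _ _ (by finiteness), shellNorm,
          ENNReal.mul_rpow_of_nonneg _ _ hτ.le, eLpNorm'_rpow _ hτ, ← ENNReal.rpow_mul,
          ENNReal.ofReal_rpow_of_pos hr, show -((d : ℝ) / τ) * τ = -d by field_simp]
        ring
  calc _ ≤ _ := h1
    _ ≤ ∑' k, ∫⁻ x in A k, F x := lintegral_iUnion_le _ _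
    _ ≤ _ := ENNReal.tsum_le_tsum h2
    _ = _ := ENNReal.tsum_mul_left

theorem le_sum_range_of_le_add {U V : ℕ → ℝ≥0∞} (h0 : U 0 ≤ V 0)
    (h : ∀ k, U (k + 1) ≤ U k + V (k + 1)) (k : ℕ) : U k ≤ ∑ j ∈ Finset.range (k + 1), V j := by
  induction k with
  | zero => simpa using h0
  | succ k ih =>
    rw [Finset.sum_range_succ]
    exact (h k).trans (by gcongr)

theorem exists_mem_dyadic {d : ℕ} {c : ℝ} (hc : 0 < c) {x : Space d} (hx : x ≠ 0) :
    ∃ n : ℤ, x ∈ (annulus (c * 2 ^ n) (c * 2 ^ n * 2) : Set (Space d)) := by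
  obtain ⟨n, h1, h2⟩ := exists_mem_Ico_zpow (div_pos (norm_pos_iff.mpr hx) hc) one_lt_two
  rw [le_div_iff₀ hc] at h1
  rw [div_lt_iff₀ hc, zpow_add_one₀ two_ne_zero] at h2
  exact ⟨n, by linarith, by linarith⟩

theorem ae_ne_zero {d : ℕ} (hd : 1 ≤ d) : ∀ᵐ x : Space d, x ≠ 0 := by
  have := ae_restrict_mem (μ := (volume : Measure (Space d))) (measurableSet_singleton 0).compl
  rw [restrict_compl_zero hd] at this
  exact this

/-- The k-th shell inward is R 2^(-k-1) ≤ |x| < R 2^(-k), where 2R/|x| > 2^(k+1). Telescoping starts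
from shell 0, just outside the ball, where u vanishes. -/
theorem inner_lintegral_le {d : ℕ} (hd : 1 ≤ d) {τ γ μ R : ℝ} (hτ : 1 ≤ τ) (hγ : γ * τ = -d)
    (hμ : 0 ≤ μ) (hR : 0 < R) {u : Space d → ℝ} {K : ℝ≥0∞}
    (hu : LocallyIntegrableOn u ({0}ᶜ : Set (Space d)) volume)
    (hs : essSupport u ⊆ Metric.ball 0 R)
    (hK : ∀ κ ι : ℕ → ℤ, Function.Injective ι →
        (∀ k, shellNorm τ R u (κ k) ≤ ∑ j ∈ Finset.range (k + 1),
          shellNorm τ R (fun x => u x - u ((2 : ℝ) • x)) (ι j)) →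
        ∑' k : ℕ, ENNReal.ofReal (((k : ℝ) + 1) ^ (-μ)) * shellNorm τ R u (κ k) ^ τ ≤ K) :
    ∫⁻ x : Space d, ENNReal.ofReal
        (‖x‖ ^ (γ * τ) / Real.log (2 * R / ‖x‖) ^ μ * |u x| ^ τ) ≤
      ENNReal.ofReal (Real.log 2 ^ (-μ)) * K := by
  have hτ0 : 0 < τ := by linarith
  have hum := aestronglyMeasurable_of_locallyIntegrableOn hd hu
  have hzero : ∀ᵐ x : Space d, R ≤ ‖x‖ → u x = 0 := by
    filter_upwards [ae_eq_zero_of_notMem_essSupport u] with x hx hRx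
    refine hx fun h => ?_
    have := hs h
    rw [mem_ball_zero_iff] at this
    linarith
  refine (lintegral_log_weight_le hτ0 hγ hμ hR u _ (fun k => -((k : ℤ) + 1)) ?_ ?_).trans ?_
  · filter_upwards [hzero, ae_ne_zero hd] with x hx hx0
    rcases le_or_gt R ‖x‖ with h | h
    · exact Or.inl (hx h)
    right
    obtain ⟨n, hn⟩ := exists_mem_dyadic hR hx0
    have hn0 : n < 0 := by
      by_contra hn0
      push Not at hn0
      have h1 : (1 : ℝ) ≤ 2 ^ n := one_le_zpow₀ one_le_two hn0
      have h2 := hn.1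
      nlinarith
    refine ⟨(-n - 1).toNat, ?_⟩
    have : -((((-n - 1).toNat : ℕ) : ℤ) + 1) = n := by omega
    simp only [this]
    exact hn
  · intro k x hx
    have h2 : R * 2 ^ (-((k : ℤ) + 1)) * 2 = R / 2 ^ k := by
      rw [zpow_neg, zpow_add_one₀ two_ne_zero, zpow_natCast]
      field_simp
    have hx0 : 0 < ‖x‖ := lt_of_lt_of_le (by positivity) hx.1
    have hx2 : ‖x‖ < R / 2 ^ k := h2 ▸ hx.2
    rw [lt_div_iff₀ (by positivity)] at hx2
    have h3 : (2 : ℝ) ^ (k + 1) ≤ 2 * R / ‖x‖ := by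
      rw [le_div_iff₀ hx0, pow_succ]
      linarith
    have h4 := Real.log_le_log (by positivity) h3
    rw [Real.log_pow] at h4
    push_cast at h4
    exact h4
  · gcongr
    refine hK _ (fun k => -((k : ℤ) + 1)) (fun i j hij => by simpa using hij) ?_
    refine le_sum_range_of_le_add (U := fun k : ℕ => shellNorm τ R u (-((k : ℤ) + 1)))
      (V := fun k : ℕ => shellNorm τ R (fun x => u x - u ((2 : ℝ) • x)) (-((k : ℤ) + 1))) ?_ ?_
    · have h1 := shellNorm_le_succ_add hτ hR hum (-1)
      have h2 : shellNorm τ R u (-1 + 1) = 0 := by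
        refine shellNorm_eq_zero hτ0 ?_
        filter_upwards [hzero] with x hx hmem
        refine hx ?_
        simpa using hmem.1
      rw [h2, zero_add] at h1
      simpa using h1
    · intro k
      have h1 := shellNorm_le_succ_add hτ hR hum (-((k : ℤ) + 1 + 1))
      rw [show -((k : ℤ) + 1 + 1) + 1 = -((k : ℤ) + 1) by ring] at h1
      push_cast
      exact h1

/-- The k-th shell outward is R 2^k ≤ |x| < R 2^(k+1), where 2|x|/R ≥ 2^(k+1). Telescoping starts
from shell -1, inside the ball, where u vanishes. -/
theorem outer_lintegral_le {d : ℕ} (hd : 1 ≤ d) {τ γ μ R : ℝ} (hτ : 1 ≤ τ) (hγ : γ * τ = -d)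
    (hμ : 0 ≤ μ) (hR : 0 < R) {u : Space d → ℝ} {K : ℝ≥0∞}
    (hu : LocallyIntegrableOn u ({0}ᶜ : Set (Space d)) volume)
    (hs : essSupport u ∩ Metric.ball 0 R = ∅)
    (hK : ∀ κ ι : ℕ → ℤ, Function.Injective ι →
        (∀ k, shellNorm τ R u (κ k) ≤ ∑ j ∈ Finset.range (k + 1),
          shellNorm τ R (fun x => u x - u ((2 : ℝ) • x)) (ι j)) →
        ∑' k : ℕ, ENNReal.ofReal (((k : ℝ) + 1) ^ (-μ)) * shellNorm τ R u (κ k) ^ τ ≤ K) :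
    ∫⁻ x : Space d, ENNReal.ofReal
        (‖x‖ ^ (γ * τ) / Real.log (2 * ‖x‖ / R) ^ μ * |u x| ^ τ) ≤
      ENNReal.ofReal (Real.log 2 ^ (-μ)) * K := by
  have hτ0 : 0 < τ := by linarith
  have hum := aestronglyMeasurable_of_locallyIntegrableOn hd hu
  have hzero : ∀ᵐ x : Space d, ‖x‖ < R → u x = 0 := by
    filter_upwards [ae_eq_zero_of_notMem_essSupport u] with x hx hRx
    refine hx fun h => ?_
    have : x ∈ essSupport u ∩ Metric.ball 0 R := ⟨h, by simpa using hRx⟩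
    rw [hs] at this
    exact this
  refine (lintegral_log_weight_le hτ0 hγ hμ hR u _ (fun k => (k : ℤ)) ?_ ?_).trans ?_
  · filter_upwards [hzero, ae_ne_zero hd] with x hx hx0
    rcases lt_or_ge ‖x‖ R with h | h
    · exact Or.inl (hx h)
    right
    obtain ⟨n, hn⟩ := exists_mem_dyadic hR hx0
    have hn0 : 0 ≤ n := by
      by_contra hn0
      push Not at hn0
      have h1 : (2 : ℝ) ^ (n + 1) ≤ 1 := zpow_le_one_of_nonpos₀ one_le_two hn0
      rw [zpow_add_one₀ two_ne_zero] at h1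
      have h2 := hn.2
      nlinarith
    refine ⟨n.toNat, ?_⟩
    have : ((n.toNat : ℕ) : ℤ) = n := by omega
    simp only [this]
    exact hn
  · intro k x hx
    have hx1 := hx.1
    rw [zpow_natCast] at hx1
    have h3 : (2 : ℝ) ^ (k + 1) ≤ 2 * ‖x‖ / R := by
      rw [le_div_iff₀ hR, pow_succ]
      linarith
    have h4 := Real.log_le_log (by positivity) h3
    rw [Real.log_pow] at h4
    push_cast at h4
    exact h4
  · gcongr
    -- The difference u - u(2·) on shell n links shells n and n+1, so reaching shell k from inside
    -- uses the index k - 1; in the inward case both indexings coincide.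
    refine hK _ (fun k => (k : ℤ) - 1) (fun i j hij => by simpa using hij) ?_
    refine le_sum_range_of_le_add (U := fun k : ℕ => shellNorm τ R u (k : ℤ))
      (V := fun k : ℕ => shellNorm τ R (fun x => u x - u ((2 : ℝ) • x)) ((k : ℤ) - 1)) ?_ ?_
    · have h1 := shellNorm_succ_le_add hτ hR hum (-1)
      have h2 : shellNorm τ R u (-1) = 0 := by
        refine shellNorm_eq_zero hτ0 ?_
        filter_upwards [hzero] with x hx hmem
        refine hx ?_
        have := hmem.2
        simpa using this
      rw [h2, zero_add] at h1
      simpa using h1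
    · intro k
      have h1 := shellNorm_succ_le_add hτ hR hum (k : ℤ)
      simpa using h1

/-! ### Degenerate cases and assembly -/

theorem eLpNorm_ofReal_eq_eLpNorm' {X F : Type*} [MeasurableSpace X] {ν : Measure X}
    [NormedAddCommGroup F] (f : X → F) {p : ℝ} (hp : 0 < p) :
    eLpNorm f (ENNReal.ofReal p) ν = eLpNorm' f p ν := by
  rw [eLpNorm_eq_eLpNorm' (by simpa using hp) ENNReal.ofReal_ne_top, ENNReal.toReal_ofReal hp.le]

theorem ae_eq_zero_of_weightedNorm_eq_zero {d : ℕ} (hd : 1 ≤ d) {β q : ℝ} (hq : 0 < q)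
    {u : Space d → ℝ} (hu : LocallyIntegrableOn u ({0}ᶜ : Set (Space d)) volume)
    (h : weightedNorm β q u = 0) : ∀ᵐ x : Space d, u x = 0 := by
  have hum := aestronglyMeasurable_of_locallyIntegrableOn hd hu
  have hw : AEStronglyMeasurable (fun x : Space d => ‖x‖ ^ β * u x) volume :=
    (measurable_norm.pow_const β).aestronglyMeasurable.mul hum
  rw [weightedNorm, eLpNorm_eq_zero_iff hw (by simpa using hq)] at h
  filter_upwards [h, ae_ne_zero hd] with x hx hx0
  exact (mul_eq_zero.mp hx).resolve_left (Real.rpow_pos_of_pos (norm_pos_iff.mpr hx0) _).ne'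

theorem logNorm_eq_zero_of_ae_eq_zero {d : ℕ} {τ : ℝ} (hτ : 0 < τ) {u : Space d → ℝ}
    (h : ∀ᵐ x : Space d, u x = 0) (W : Space d → ℝ) :
    (∫⁻ x : Space d, ENNReal.ofReal (W x * |u x| ^ τ)) ^ (1 / τ) = 0 := by
  have : ∫⁻ x : Space d, ENNReal.ofReal (W x * |u x| ^ τ) = 0 := by
    rw [← lintegral_zero (α := Space d) (μ := volume)]
    refine lintegral_congr_ae ?_
    filter_upwards [h] with x hx
    simp [hx, hτ.ne']
  rw [this, ENNReal.zero_rpow_of_pos (by positivity)]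

/-- If `u` has no weak gradient in `L^p_loc`, the right-hand side is infinite unless `u = 0`. -/
theorem logNorm_le_of_weightedGradNorm_eq_top {d : ℕ} (hd : 1 ≤ d) {q τ a β : ℝ} (hq : 0 < q)
    (hτ : 0 < τ) (ha₀ : 0 < a) (ha₁ : a ≤ 1) {u : Space d → ℝ}
    (hu : LocallyIntegrableOn u ({0}ᶜ : Set (Space d)) volume) {C G : ℝ≥0∞} (hC : C ≠ 0)
    (hG : G = ⊤) (W : Space d → ℝ) :
    (∫⁻ x : Space d, ENNReal.ofReal (W x * |u x| ^ τ)) ^ (1 / τ) ≤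
      C * (G ^ a * weightedNorm β q u ^ (1 - a)) := by
  by_cases h : weightedNorm β q u ^ (1 - a) = 0
  · have hN : weightedNorm β q u = 0 := by
      rcases ENNReal.rpow_eq_zero_iff.mp h with h | h
      · exact h.1
      · linarith [h.2]
    rw [logNorm_eq_zero_of_ae_eq_zero hτ (ae_eq_zero_of_weightedNorm_eq_zero hd hq hu hN)]
    exact zero_le
  · rw [hG, ENNReal.top_rpow_of_pos ha₀, ENNReal.top_mul h, ENNReal.mul_top hC]
    exact le_top

theorem rpow_one_div_le_of_le {I B D C X : ℝ≥0∞} {τ : ℝ} (hτ : 0 < τ)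
    (h : I ≤ D * (B * X ^ τ)) (hC : (D * B) ^ (1 / τ) ≤ C) : I ^ (1 / τ) ≤ C * X := by
  calc I ^ (1 / τ) ≤ (D * (B * X ^ τ)) ^ (1 / τ) := by gcongr
    _ = (D * B) ^ (1 / τ) * X := by
      rw [← mul_assoc, ENNReal.mul_rpow_of_nonneg _ _ (by positivity), ← ENNReal.rpow_mul,
        mul_one_div_cancel hτ.ne', ENNReal.rpow_one]
    _ ≤ _ := by gcongr

end CKN

theorem mainTheorem8 (d : ℕ) (hd : 1 ≤ d) (p q τ a α β γ σ μ : ℝ)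
    (hp : 1 ≤ p) (hq : 1 ≤ q) (hτ : 1 ≤ τ) (ha0 : 0 < a) (ha1 : a ≤ 1)
    (hμ : 1 < μ) (hτμ : τ ≤ μ)
    (hσ : γ = a * σ + (1 - a) * β)
    (hbalance : 1 / τ + γ / d = a * (1 / p + (α - 1) / d) + (1 - a) * (1 / q + β / d))
    (hασ0 : 0 ≤ α - σ) (hασ1 : α - σ ≤ 1) :
    ∃ C : ℝ, 0 < C ∧ ∀ u : CKN.Space d → ℝ,
      LocallyIntegrableOn u ({0}ᶜ : Set (CKN.Space d)) volume →
      ∀ R₁ R₂ : ℝ, 0 < R₁ → 0 < R₂ →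
        (1 / τ + γ / d = 0 → CKN.essSupport u ⊆ Metric.ball 0 R₂ →
          CKN.innerLogNorm γ τ μ R₂ u ≤
            ENNReal.ofReal C *
              (CKN.weightedGradNorm α p u ^ a * CKN.weightedNorm β q u ^ (1 - a))) ∧
        (1 / τ + γ / d = 0 → CKN.essSupport u ∩ Metric.ball 0 R₁ = ∅ →
          CKN.outerLogNorm γ τ μ R₁ u ≤
            ENNReal.ofReal C *
              (CKN.weightedGradNorm α p u ^ a * CKN.weightedNorm β q u ^ (1 - a))) := by
  by_cases hcrit : 1 / τ + γ / d = 0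
  swap
  -- Off the critical line both claims are vacuous.
  · exact ⟨1, one_pos, fun u _ R₁ R₂ _ _ => ⟨fun h => absurd h hcrit, fun h => absurd h hcrit⟩⟩
  have hd0 : (0 : ℝ) < d := by positivity
  have hτ0 : 0 < τ := by linarith
  have hp0 : 0 < p := by linarith
  have hq0 : 0 < q := by linarith
  have hγτ : γ * τ = -d := by
    field_simp at hcrit
    linarith
  -- Inserting γ = aσ + (1-a)β into the balance law eliminates β; the two bounds on α - σ then give
  -- the two exponent conditions.
  have hlocal : 1 / τ - (a * (1 / p) + (1 - a) * (1 / q)) = a * ((α - σ) - 1) / d := by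
    have : 1 / τ = a * (1 / p + (α - 1) / d) + (1 - a) * (1 / q + β / d) - γ / d := by linarith
    rw [this, hσ]
    ring
  have h₁ : a * (1 / p - 1 / d) + (1 - a) * (1 / q) ≤ 1 / τ := by
    have : 0 ≤ a * (α - σ) / d := by positivity
    have e : a * ((α - σ) - 1) / d = a * (α - σ) / d - a * (1 / d) := by ring
    rw [e] at hlocal
    linarith
  have h₂ : 1 / τ ≤ a * (1 / p) + (1 - a) * (1 / q) := by
    have : a * ((α - σ) - 1) / d ≤ 0 :=
      div_nonpos_of_nonpos_of_nonneg (mul_nonpos_of_nonneg_of_nonpos ha0.le (by linarith)) hd0.le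
    linarith
  have hbal : a * (α - 1 + d / p) + (1 - a) * (β + d / q) = 0 := by
    rw [hcrit] at hbalance
    have : a * (α - 1 + d / p) + (1 - a) * (β + d / q) =
        d * (a * (1 / p + (α - 1) / d) + (1 - a) * (1 / q + β / d)) := by
      field_simp
      ring
    rw [this, ← hbalance, mul_zero]
  obtain ⟨B, hB, hest⟩ := CKN.exists_dyadic_estimate hd hp hq hτ ha0 ha1 hμ hτμ h₁ h₂ hbal
  set D := ENNReal.ofReal (Real.log 2 ^ (-μ)) with hD
  have hDB : (D * B) ^ (1 / τ) ≠ ⊤ := by finiteness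
  -- The added 1 keeps the constant nonzero, so that its product with an infinite right side remains
  -- infinite.
  refine ⟨((D * B) ^ (1 / τ)).toReal + 1, by positivity, fun u hu R₁ R₂ hR₁ hR₂ => ?_⟩
  have hC : (D * B) ^ (1 / τ) ≤ ENNReal.ofReal (((D * B) ^ (1 / τ)).toReal + 1) := by
    refine ENNReal.le_ofReal_iff_toReal_le hDB (by positivity) |>.mpr ?_
    linarith
  have hC0 : ENNReal.ofReal (((D * B) ^ (1 / τ)).toReal + 1) ≠ 0 := by
    rw [ENNReal.ofReal_ne_zero_iff]
    positivity
  by_cases hg : ∃ g : CKN.Space d → CKN.Space d, CKN.IsWeakGradient u g ∧ CKN.MemLpLoc g p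
  · obtain ⟨g, hg, hgp⟩ := hg
    rw [CKN.weightedGradNorm_eq hg hgp, CKN.restrict_compl_zero hd, CKN.weightedNorm,
      CKN.eLpNorm_ofReal_eq_eLpNorm' _ hp0, CKN.eLpNorm_ofReal_eq_eLpNorm' _ hq0]
    refine ⟨fun _ hs => ?_, fun _ hs => ?_⟩
    · refine CKN.rpow_one_div_le_of_le hτ0 ?_ hC
      exact CKN.inner_lintegral_le hd hτ hγτ (by linarith) hR₂ hu hs (hest u g hu hg R₂ hR₂)
    · refine CKN.rpow_one_div_le_of_le hτ0 ?_ hC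
      exact CKN.outer_lintegral_le hd hτ hγτ (by linarith) hR₁ hu hs (hest u g hu hg R₁ hR₁)
  · have hG : CKN.weightedGradNorm α p u = ⊤ := by
      rw [CKN.weightedGradNorm, dif_neg hg]
    exact ⟨fun _ _ => CKN.logNorm_le_of_weightedGradNorm_eq_top hd hq0 hτ0 ha0 ha1 hu hC0 hG _,
      fun _ _ => CKN.logNorm_le_of_weightedGradNorm_eq_top hd hq0 hτ0 ha0 ha1 hu hC0 hG _⟩
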